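/- Let $d\ge 1$, let $r\in(d,\infty]$ and $q\in(2,\infty]$, with $r\ge 2$ (automatic when $d\ge 2$), satisfy $$\delta_1:=\frac12-\frac{d}{2r}-\frac1q>0 \qquad (d/\infty=1/\infty=0).$$ Then there is a constant $C_3=C_3(d,r,q)>0$ such that the following holds for every standard $d$-dimensional Brownian motion $B$ started from $0$ (with expectation $\mathbb E$), every $\sigma>0$, $T>0$, $t\in[0,T]$, $a\in\mathbb R^d$ and $n\ge 1$, all continuously differentiable functions $b^1,\dots,b^n:\mathbb R^d\times[0,T]\to\mathbb R$ of compact support, and all indices $\alpha_1,\dots,\alpha_n\in\{1,\dots,d\}$: $$\left|\mathbb E\int_{\Delta^n(t)}\prod_{i=1}^n b^i_{x^{\alpha_i}}\big(a+\sigma B(t_i),t_i\big)\,dt_1\cdots dt_n\right|\le C_3^n\,\sigma^{-n\left(\frac dr+1\right)}\,n^{-n\delta_1}\,t^{n\delta_1}\prod_{i=1}^n\|b^i\|_{r,q}.$$ Here $f_{x^k}$ is the partial derivative of $f$ in the $k$-th spatial coordinate, $\Delta^n(t)=\{(t_1,\dots,t_n):0\le t_1\le\dots\le t_n\le t\}$,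 and $$\|f\|_{r,q}=\left[\int_0^T\left(\int_{\mathbb R^d}|f(x,t)|^r\,dx\right)^{q/r}dt\right]^{1/q},$$ with essential suprema in place of the integrals when $r$ or $q$ is infinite. -/

import Mathlib

open MeasureTheory ProbabilityTheory Set
open scoped ENNReal NNReal

noncomputable section

namespace DavieBound

/-- `d / r` for an exponent `r ∈ [1, ∞]`, with `d / ∞ = 0`. -/
def dimRatio (d : ℕ) (r : ℝ≥0∞) : ℝ := d * (r⁻¹).toReal

/-- The exponent `δ₁ = 1/2 - d/(2r) - 1/q`, with `d/∞ = 1/∞ = 0`. -/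
def delta1 (d : ℕ) (r q : ℝ≥0∞) : ℝ := 1 / 2 - dimRatio d r / 2 - (q⁻¹).toReal

/-- The mixed norm of `L^{r,q}` on `ℝᵈ × [0,T]`: the `L^q` norm over `t ∈ [0,T]` of the
`L^r(ℝᵈ)` norm of `f(·,t)`; an infinite exponent means the essential supremum. -/
def mixedNorm {d : ℕ} (T : ℝ) (r q : ℝ≥0∞) (f : EuclideanSpace ℝ (Fin d) → ℝ → ℝ) : ℝ≥0∞ :=
  eLpNorm (fun t : ℝ => eLpNorm (fun x => f x t) r volume) q (volume.restrict (Icc 0 T))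

/-- The ordered simplex `{(t₁, …, tₙ) : 0 ≤ t₁ ≤ ⋯ ≤ tₙ ≤ t}`. -/
def orderedSimplex (n : ℕ) (t : ℝ) : Set (Fin n → ℝ) :=
  {s | Monotone s ∧ ∀ i, s i ∈ Icc 0 t}

/-- The spatial partial derivative `∂f/∂x^k` at `(x, t)`. -/
def spatialDeriv {d : ℕ} (k : Fin d) (f : EuclideanSpace ℝ (Fin d) → ℝ → ℝ)
    (x : EuclideanSpace ℝ (Fin d)) (t : ℝ) : ℝ :=
  lineDeriv ℝ (fun y => f y t) x (EuclideanSpace.single k 1)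

/-- `f` is a continuously differentiable function of compact support on the closed slab
`ℝᵈ × [0,T]` (it need not vanish at `t = 0` or `t = T`; its values at other times play no role). -/
structure IsC1CompactlySupported {d : ℕ} (T : ℝ) (f : EuclideanSpace ℝ (Fin d) → ℝ → ℝ) :
    Prop where
  contDiffOn :
    ContDiffOn ℝ 1 (fun p : EuclideanSpace ℝ (Fin d) × ℝ => f p.1 p.2) (univ ×ˢ Icc 0 T)
  hasCompactSupport :
    HasCompactSupport (fun p : EuclideanSpace ℝ (Fin d) × Icc (0 : ℝ) T => f p.1 p.2)

/-- `B` is a standard `d`-dimensional Brownian motion started from `0`: its coordinates are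
independent one-dimensional standard Brownian motions. -/
structure IsStandardBrownian {d : ℕ} {Ω : Type*} [MeasurableSpace Ω]
    (B : ℝ≥0 → Ω → EuclideanSpace ℝ (Fin d)) (P : Measure Ω) : Prop where
  coord : ∀ k, IsBrownianReal (fun t ω => B t ω k) P
  indep : iIndepFun (fun (k : Fin d) (ω : Ω) (t : ℝ≥0) => B t ω k) P

end DavieBound

end

/-! Put a weight `e^{-λ tₙ}` on the simplex, times a terminal function `h` evaluated at the position
at time `tₙ`. By the Markov property at `tₙ₋₁`, integrating out the last time gives an integral of
the same shape with one variable fewer, in which `h` is replaced by `Res (∂b · h)`. Here `Res` is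
the λ-resolvent of space-time Brownian motion, the inverse of `λ - (∂ₜ + σ²Δ/2)`; this is
`integral_pathProd_snoc`. Starting from `h = e^{λs}` on `[0,t]`, suitably cut off, cancels the
weight and costs a factor `e^{2λt}`. It remains to bound the single operator `W ↦ V = Res (∂ₖb · W)`
in a norm that can be iterated.

The norm combines `m ≥ sup |W|` with an energy `n²` that dominates `σ² Res ((∂ₖW)²)` at every point
and in every direction. Only `b`, never `∂b`, may be estimated, so write `∂b·W = ∂(bW) - b ∂W`. In
the first term Gaussian integration by parts replaces the derivative by the factor `z_k/(σ√τ)`, and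
Cauchy–Schwarz leaves the root mean square of `b`. The second term is Cauchy–Schwarz against the
energy of `W`. The energy of `V` comes from applying `λ - (∂ₜ + σ²Δ/2)` to `V²` (`energy_Res_le`),
followed by the same integration by parts and a quadratic inequality. In `energyBound_step` each
factor `b` therefore multiplies `m + n` by at most `4β`.

The size `β` is governed by two Kato type integrals. Hölder in space against the Gaussian and Hölder
in time against a power times an exponential bound both by the same quantity, a constant times
`σ^{-(d/r+1)} λ^{-δ₁} ‖b‖` (`katoBound_of_mixedNorm`). Taking `λ = n/t` turns `λ^{-nδ₁}` into
`n^{-nδ₁} t^{nδ₁}`, while `e^{2λt} = e^{2n}` disappears into the constant.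

All this is done for smooth compactly supported functions that vanish after time `t`. The general
case follows by freezing `b` in time outside the slab, mollifying and cutting off in time
(`exists_smooth_approx`), and then dominated convergence. -/

namespace DavieBound

/-! ### Gaussian density, integration by parts, and `L^r` control of Gaussian averages. -/

/-- The state space `ℝᵈ` with its Euclidean norm. -/
abbrev Sp (d : ℕ) : Type := EuclideanSpace ℝ (Fin d)

/-- The density of the standard Gaussian law on `ℝᵈ`. -/
noncomputable def gaussDensity {d : ℕ} (z : Sp d) : ℝ :=
  (2 * Real.pi) ^ (-(d : ℝ) / 2) * Real.exp (-(1 / 2) * ‖z‖ ^ 2)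

lemma gaussDensity_nonneg {d : ℕ} (z : Sp d) : 0 ≤ gaussDensity z := by
  unfold gaussDensity; positivity

lemma continuous_gaussDensity {d : ℕ} : Continuous (gaussDensity (d := d)) := by
  unfold gaussDensity; fun_prop

lemma integrable_exp_neg_mul_norm_sq {d : ℕ} {b : ℝ} (hb : 0 < b) :
    Integrable (fun z : Sp d => Real.exp (-b * ‖z‖ ^ 2)) := by
  have h := (GaussianFourier.integrable_cexp_neg_mul_sq_norm_add (V := Sp d)
    (b := (b : ℂ)) (by simpa using hb) 0 0).norm
  refine h.congr (.of_forall fun z => ?_)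
  simp only [Complex.norm_exp]
  norm_cast
  simp

lemma integrable_gaussDensity {d : ℕ} : Integrable (gaussDensity (d := d)) :=
  (integrable_exp_neg_mul_norm_sq (by norm_num)).const_mul _

/-- Both finite measures have the same characteristic function, by the explicit Fourier transform of
a Gaussian. -/
lemma stdGaussian_eq_withDensity (d : ℕ) :
    stdGaussian (Sp d) = volume.withDensity (fun z => ENNReal.ofReal (gaussDensity z)) := by
  have : IsFiniteMeasure (volume.withDensity (fun z : Sp d => ENNReal.ofReal (gaussDensity z))) :=
    isFiniteMeasure_withDensity_ofReal integrable_gaussDensity.2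
  apply Measure.ext_of_charFun
  ext t
  rw [charFun_stdGaussian, charFun_apply, integral_withDensity_eq_integral_toReal_smul
    (by have := continuous_gaussDensity (d := d); fun_prop) (by simp)]
  have key := GaussianFourier.integral_cexp_neg_mul_sq_norm_add (V := Sp d)
    (b := (1 / 2 : ℂ)) (by norm_num) Complex.I t
  have : ∀ z : Sp d, (ENNReal.ofReal (gaussDensity z)).toReal •
      Complex.exp ((inner ℝ z t : ℝ) * Complex.I) =
      (((2 * Real.pi) ^ (-(d : ℝ) / 2) : ℝ) : ℂ) *
        Complex.exp (-(1 / 2) * ‖z‖ ^ 2 + Complex.I * (inner ℝ t z : ℝ)) := by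
    intro z
    rw [ENNReal.toReal_ofReal (gaussDensity_nonneg z), gaussDensity, Complex.real_smul,
      Complex.exp_add, real_inner_comm]
    push_cast
    ring_nf
  simp_rw [this]
  rw [integral_const_mul, key]
  have h2 : (Real.pi / (1 / 2 : ℂ)) = ((2 * Real.pi : ℝ) : ℂ) := by push_cast; ring
  have h3 : ((Module.finrank ℝ (Sp d) : ℂ) / 2) = (((d : ℝ) / 2 : ℝ) : ℂ) := by simp
  rw [h2, h3, ← Complex.ofReal_cpow (by positivity), ← mul_assoc, ← Complex.ofReal_mul,
    ← Real.rpow_add (by positivity)]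
  have : -(d : ℝ) / 2 + d / 2 = 0 := by ring
  rw [this]
  simp
  ring_nf

lemma integral_stdGaussian {d : ℕ} (f : Sp d → ℝ) :
    ∫ z, f z ∂(stdGaussian (Sp d)) = ∫ z, gaussDensity z * f z := by
  rw [stdGaussian_eq_withDensity, integral_withDensity_eq_integral_toReal_smul
    (by have := continuous_gaussDensity (d := d); fun_prop) (by simp)]
  simp [ENNReal.toReal_ofReal, gaussDensity_nonneg]

lemma integrable_stdGaussian_iff {d : ℕ} {f : Sp d → ℝ} :
    Integrable f (stdGaussian (Sp d)) ↔ Integrable (fun z => gaussDensity z * f z) := by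
  rw [stdGaussian_eq_withDensity, integrable_withDensity_iff_integrable_smul'
    (by have := continuous_gaussDensity (d := d); fun_prop) (by simp)]
  simp [ENNReal.toReal_ofReal, gaussDensity_nonneg]

lemma hasFDerivAt_gaussDensity {d : ℕ} (z : Sp d) :
    HasFDerivAt gaussDensity (-gaussDensity z • innerSL ℝ z) z := by
  have h1 : HasFDerivAt (fun z : Sp d => -(1 / 2) * ‖z‖ ^ 2) (-innerSL ℝ z) z :=
    ((hasStrictFDerivAt_norm_sq z).hasFDerivAt.const_mul (-(1 / 2) : ℝ)).congr_fderiv (by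
      ext v; simp)
  refine (h1.exp.const_mul ((2 * Real.pi) ^ (-(d : ℝ) / 2))).congr_fderiv ?_
  ext v
  simp [gaussDensity]
  ring

/-- The coordinates of a standard Gaussian vector are standard Gaussian variables. -/
lemma map_coord_stdGaussian {d : ℕ} (k : Fin d) :
    (stdGaussian (Sp d)).map (fun z => z k) = gaussianReal 0 1 := by
  rw [← map_pi_eq_stdGaussian, Measure.map_map (by fun_prop) (by fun_prop)]
  exact (measurePreserving_eval (fun _ : Fin d => gaussianReal 0 1) k).map_eq

lemma integrable_coord_sq {d : ℕ} (k : Fin d) :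
    Integrable (fun z : Sp d => (z k) ^ 2) (stdGaussian (Sp d)) := by
  have : Integrable (fun x : ℝ => x ^ 2) ((stdGaussian (Sp d)).map (fun z => z k)) := by
    rw [map_coord_stdGaussian]
    exact (memLp_id_gaussianReal 2).integrable_sq
  exact this.comp_measurable (by fun_prop)

lemma integral_coord_sq {d : ℕ} (k : Fin d) :
    ∫ z, (z k) ^ 2 ∂(stdGaussian (Sp d)) = 1 := by
  have h : ∫ x, x ^ 2 ∂((stdGaussian (Sp d)).map (fun z => z k)) = 1 := by
    rw [map_coord_stdGaussian]
    have := variance_fun_id_gaussianReal (μ := 0) (v := 1)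
    rw [variance_eq_sub (X := fun x => x) (memLp_id_gaussianReal 2)] at this
    simpa using this
  rw [← h, integral_map (by fun_prop) (by fun_prop)]

lemma integrable_coord {d : ℕ} (k : Fin d) :
    Integrable (fun z : Sp d => z k) (stdGaussian (Sp d)) :=
  ((memLp_two_iff_integrable_sq (by fun_prop)).2 (integrable_coord_sq k)).integrable (by norm_num)

lemma integrable_mul_coord {d : ℕ} {f : Sp d → ℝ} (hf : Continuous f) {C : ℝ}
    (hC : ∀ z, |f z| ≤ C) (k : Fin d) :
    Integrable (fun z => f z * z k) (stdGaussian (Sp d)) :=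
  (integrable_coord k).bdd_mul hf.aestronglyMeasurable (.of_forall hC)

lemma integrable_of_continuous_bdd {α : Type*} [TopologicalSpace α] [MeasurableSpace α]
    [OpensMeasurableSpace α] {μ : Measure α} [IsFiniteMeasure μ] {f : α → ℝ} (hf : Continuous f)
    {C : ℝ} (hC : ∀ z, |f z| ≤ C) : Integrable f μ :=
  Integrable.of_bound hf.aestronglyMeasurable C (.of_forall hC)

/-- Gaussian integration by parts. -/
lemma stein {d : ℕ} {f : Sp d → ℝ} (hf : ContDiff ℝ 1 f) {C C' : ℝ} (k : Fin d)
    (hC : ∀ z, |f z| ≤ C) (hC' : ∀ z, |fderiv ℝ f z (EuclideanSpace.single k 1)| ≤ C') :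
    ∫ z, f z * z k ∂(stdGaussian (Sp d))
      = ∫ z, fderiv ℝ f z (EuclideanSpace.single k 1) ∂(stdGaussian (Sp d)) := by
  have hd : ∀ z : Sp d, fderiv ℝ gaussDensity z (EuclideanSpace.single k 1)
      = - (gaussDensity z * z k) := by
    intro z
    rw [(hasFDerivAt_gaussDensity z).fderiv]
    simp [EuclideanSpace.inner_single_right]
  have hcont : Continuous fun z => fderiv ℝ f z (EuclideanSpace.single k 1) :=
    (hf.continuous_fderiv one_ne_zero).clm_apply continuous_const
  have i1 := integrable_stdGaussian_iff.1 (integrable_mul_coord hf.continuous hC k)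
  have i2 := integrable_stdGaussian_iff.1
    (integrable_of_continuous_bdd (μ := stdGaussian (Sp d)) hcont hC')
  have i3 := integrable_stdGaussian_iff.1
    (integrable_of_continuous_bdd (μ := stdGaussian (Sp d)) hf.continuous hC)
  have := integral_mul_fderiv_eq_neg_fderiv_mul_of_integrable (μ := (volume : Measure (Sp d)))
    (f := gaussDensity) (g := f) (v := EuclideanSpace.single k 1)
    (by refine i1.neg.congr (.of_forall fun z => ?_); simp only [hd, Pi.neg_apply]; ring)
    i2 i3 (fun z _ => (hasFDerivAt_gaussDensity z).differentiableAt)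
    (fun z _ => (hf.differentiable one_ne_zero) z)
  rw [integral_stdGaussian, integral_stdGaussian, this, ← integral_neg]
  congr 1 with z
  rw [hd]; ring

/-- Cauchy–Schwarz, the coordinate having unit variance. This controls the factor `z_k` produced by
integration by parts. -/
lemma integral_abs_mul_coord_le {d : ℕ} {f : Sp d → ℝ} (hf : Continuous f) {C : ℝ}
    (hC : ∀ z, |f z| ≤ C) (k : Fin d) :
    ∫ z, |f z| * |z k| ∂(stdGaussian (Sp d)) ≤ √(∫ z, (f z) ^ 2 ∂(stdGaussian (Sp d))) := by
  have h := integral_mul_norm_le_Lp_mul_Lq (μ := stdGaussian (Sp d)) (f := f)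
    (g := fun z : Sp d => z k) Real.HolderConjugate.two_two
    (by simpa using MemLp.of_bound hf.aestronglyMeasurable C (.of_forall hC))
    (by simpa using (memLp_two_iff_integrable_sq (by fun_prop)).2 (integrable_coord_sq k))
  simpa [Real.sqrt_eq_rpow, integral_coord_sq] using h

/-- All exponents are needed, `∞` included: the Hölder exponent `(1/2 - 1/r)⁻¹` is infinite at `r =
2`. -/
lemma memLp_exp_neg_mul_norm_sq {d : ℕ} {b : ℝ} (hb : 0 < b) (p : ℝ≥0∞) :
    MemLp (fun z : Sp d => Real.exp (-b * ‖z‖ ^ 2)) p := by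
  have hm : AEStronglyMeasurable (fun z : Sp d => Real.exp (-b * ‖z‖ ^ 2)) volume := by fun_prop
  rcases eq_or_ne p 0 with rfl | h0
  · simpa using hm
  rcases eq_or_ne p ∞ with rfl | hp
  · refine memLp_top_of_bound hm 1 (.of_forall fun z => ?_)
    rw [Real.norm_eq_abs, abs_of_nonneg (Real.exp_nonneg _), Real.exp_le_one_iff]
    nlinarith [sq_nonneg ‖z‖]
  · rw [← integrable_norm_rpow_iff hm h0 hp]
    have hp' := ENNReal.toReal_pos h0 hp
    refine (integrable_exp_neg_mul_norm_sq (d := d) (mul_pos hb hp')).congr (.of_forall fun z => ?_)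
    simp only [Real.norm_eq_abs, Real.abs_exp]
    rw [← Real.exp_mul]
    ring_nf

lemma sqrt_gaussDensity {d : ℕ} (z : Sp d) : √(gaussDensity z)
    = √((2 * Real.pi) ^ (-(d : ℝ) / 2)) * Real.exp (-(1 / 4) * ‖z‖ ^ 2) := by
  rw [gaussDensity, Real.sqrt_mul (by positivity), Real.sqrt_eq_rpow (Real.exp _), ← Real.exp_mul]
  ring_nf

/-- The constant in the bound of Gaussian averages of squares by `L^r` norms. -/
noncomputable def gaussConst (d : ℕ) (r : ℝ≥0∞) : ℝ≥0∞ :=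
  eLpNorm (fun z : Sp d => √(gaussDensity z)) (2⁻¹ - r⁻¹)⁻¹ volume

lemma gaussConst_lt_top (d : ℕ) (r : ℝ≥0∞) : gaussConst d r < ∞ := by
  have := (memLp_exp_neg_mul_norm_sq (d := d) (b := 1 / 4) (by norm_num) (2⁻¹ - r⁻¹)⁻¹).const_mul
    (√((2 * Real.pi) ^ (-(d : ℝ) / 2)))
  rw [gaussConst]
  simp_rw [sqrt_gaussDensity]
  exact this.2

/-- The affine map scales Lebesgue measure by `c^{-d}`, and the norm sees its `1/r`-th power; at `r
= ∞` the factor is `1`. -/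
lemma eLpNorm_comp_affine {d : ℕ} (r : ℝ≥0∞) {f : Sp d → ℝ} (hf : Continuous f) (x : Sp d)
    {c : ℝ} (hc : 0 < c) :
    eLpNorm (fun z => f (x + c • z)) r volume
      = ENNReal.ofReal (c ^ (-dimRatio d r)) * eLpNorm f r volume := by
  have hmap : (volume : Measure (Sp d)).map (fun z => x + c • z)
      = ENNReal.ofReal (c ^ (-(d : ℝ))) • volume := by
    have : (fun z : Sp d => x + c • z) = (fun z => x + z) ∘ (fun z => c • z) := rfl
    rw [this, ← Measure.map_map (by fun_prop) (by fun_prop), Measure.map_addHaar_smul _ hc.ne',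
      Measure.map_smul, map_add_left_eq_self, finrank_euclideanSpace_fin,
      abs_of_nonneg (by positivity), Real.rpow_neg hc.le, Real.rpow_natCast]
  have h := eLpNorm_map_measure (p := r) (μ := (volume : Measure (Sp d)))
    (f := fun z => x + c • z) (g := f) hf.aestronglyMeasurable (by fun_prop)
  rw [hmap, eLpNorm_smul_measure_of_ne_zero (by simp; positivity)] at h
  rw [show (fun z => f (x + c • z)) = f ∘ (fun z => x + c • z) from rfl, ← h, smul_eq_mul,
    ENNReal.ofReal_rpow_of_pos (by positivity), ← Real.rpow_mul hc.le, dimRatio, one_div, neg_mul]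

/-- A Gaussian average of a square is controlled by the `L^r` norm, `r ≥ 2`. -/
lemma lintegral_sq_comp_affine_le {d : ℕ} {r : ℝ≥0∞} (hr : 2 ≤ r) {f : Sp d → ℝ}
    (hf : Continuous f) (x : Sp d) {c : ℝ} (hc : 0 < c) :
    ∫⁻ z, ‖f (x + c • z)‖ₑ ^ 2 ∂(stdGaussian (Sp d))
      ≤ (gaussConst d r * ENNReal.ofReal (c ^ (-dimRatio d r)) * eLpNorm f r volume) ^ 2 := by
  have hcd := continuous_gaussDensity (d := d)
  -- Here `2 ≤ r` is essential, as the subtraction of exponents is truncated.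
  have : ENNReal.HolderTriple (2⁻¹ - r⁻¹)⁻¹ r 2 := ⟨by
    rw [inv_inv, tsub_add_cancel_of_le (ENNReal.inv_le_inv.2 hr)]⟩
  have h := eLpNorm_smul_le_mul_eLpNorm (μ := (volume : Measure (Sp d))) (r := 2)
    (f := fun z => f (x + c • z)) (φ := fun z => √(gaussDensity z))
    (p := (2⁻¹ - r⁻¹)⁻¹) (q := r) (by fun_prop) (by fun_prop)
  rw [eLpNorm_comp_affine r hf x hc] at h
  -- The Gaussian `L²` norm of `f` is the Lebesgue `L²` norm of `√density · f`, to which Hölder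
  -- applies.
  calc ∫⁻ z, ‖f (x + c • z)‖ₑ ^ 2 ∂(stdGaussian (Sp d))
      = (eLpNorm ((fun z => √(gaussDensity z)) • fun z => f (x + c • z)) 2 volume) ^ 2 := by
        have hm : Continuous fun z => ‖f (x + c • z)‖ₑ ^ 2 := by fun_prop
        rw [stdGaussian_eq_withDensity, lintegral_withDensity_eq_lintegral_mul _ (by fun_prop)
          hm.measurable]
        have h2 := eLpNorm_nnreal_pow_eq_lintegral (μ := (volume : Measure (Sp d)))
          (f := (fun z : Sp d => √(gaussDensity z)) • fun z : Sp d => f (x + c • z))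
          (p := 2) (by norm_num)
        simp only [NNReal.coe_ofNat, ENNReal.rpow_ofNat, ENNReal.coe_ofNat] at h2
        rw [h2]
        congr 1 with z
        simp only [Pi.mul_apply, Pi.smul_apply', smul_eq_mul, enorm_mul, mul_pow]
        congr 1
        rw [← ofReal_norm, Real.norm_of_nonneg (Real.sqrt_nonneg _), ← ENNReal.ofReal_pow
          (Real.sqrt_nonneg _), Real.sq_sqrt (gaussDensity_nonneg z)]
    _ ≤ _ := by
        rw [mul_assoc]
        exact pow_le_pow_left₀ zero_le h 2

end DavieBound

/-! ### The resolvent of space-time Brownian motion and its generator. -/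

namespace DavieBound

open Filter Topology
open scoped ContDiff

/-- The measure `e^{-λτ} dτ` on `(0, ∞)`. -/
noncomputable def timeLaw (lam : ℝ) : Measure ℝ :=
  (volume.restrict (Ioi 0)).withDensity (fun τ => ENNReal.ofReal (Real.exp (-lam * τ)))

instance isFiniteMeasure_timeLaw {lam : ℝ} [hl : Fact (0 < lam)] :
    IsFiniteMeasure (timeLaw lam) :=
  isFiniteMeasure_withDensity_ofReal (integrableOn_exp_mul_Ioi (by linarith [hl.out]) 0).2

lemma integral_timeLaw (lam : ℝ) (g : ℝ → ℝ) :
    ∫ τ, g τ ∂(timeLaw lam) = ∫ τ in Ioi 0, Real.exp (-lam * τ) * g τ := by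
  rw [timeLaw, integral_withDensity_eq_integral_toReal_smul (by fun_prop) (by simp)]
  simp [ENNReal.toReal_ofReal, Real.exp_nonneg]

lemma integrable_timeLaw_iff {lam : ℝ} {g : ℝ → ℝ} :
    Integrable g (timeLaw lam) ↔ IntegrableOn (fun τ => Real.exp (-lam * τ) * g τ) (Ioi 0) := by
  rw [timeLaw, integrable_withDensity_iff_integrable_smul' (by fun_prop) (by simp)]
  simp [ENNReal.toReal_ofReal, Real.exp_nonneg, IntegrableOn]

/-- The law of a killed time and an independent standard Gaussian vector. -/
noncomputable def killedLaw (d : ℕ) (lam : ℝ) : Measure (ℝ × Sp d) :=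
  (timeLaw lam).prod (stdGaussian (Sp d))

instance {d : ℕ} {lam : ℝ} [Fact (0 < lam)] : IsFiniteMeasure (killedLaw d lam) := by
  unfold killedLaw; infer_instance

/-- Space-time displacement of Brownian motion with diffusivity `σ` after time `τ`. -/
noncomputable def shift {d : ℕ} (σ : ℝ) (w : ℝ × Sp d) : Sp d × ℝ := ((σ * √w.1) • w.2, w.1)

lemma continuous_shift {d : ℕ} (σ : ℝ) : Continuous (shift (d := d) σ) := by
  unfold shift; fun_prop

/-- The resolvent of space-time Brownian motion. -/
noncomputable def Res {d : ℕ} (σ lam : ℝ) (f : Sp d × ℝ → ℝ) (p : Sp d × ℝ) : ℝ :=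
  ∫ w, f (p + shift σ w) ∂(killedLaw d lam)

/-- Directional derivative. -/
noncomputable def dd {d : ℕ} (v : Sp d × ℝ) (f : Sp d × ℝ → ℝ) (p : Sp d × ℝ) : ℝ :=
  fderiv ℝ f p v

/-- The `k`-th spatial basis vector of space-time. -/
noncomputable def eS {d : ℕ} (k : Fin d) : Sp d × ℝ := (EuclideanSpace.single k 1, 0)

/-- The time basis vector of space-time. -/
def eT {d : ℕ} : Sp d × ℝ := (0, 1)

/-- The generator `∂ₜ + σ²Δ/2` of space-time Brownian motion. -/
noncomputable def gen {d : ℕ} (σ : ℝ) (f : Sp d × ℝ → ℝ) (p : Sp d × ℝ) : ℝ :=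
  dd eT f p + σ ^ 2 / 2 * ∑ k, dd (eS k) (dd (eS k) f) p

/-- Bounded smooth functions on space-time with bounded first and second derivatives. -/
structure SmoothBdd {d : ℕ} (f : Sp d × ℝ → ℝ) : Prop where
  smooth : ContDiff ℝ ∞ f
  bdd : ∃ C, ∀ p, |f p| ≤ C
  bdd_dd : ∀ v, ∃ C, ∀ p, |dd v f p| ≤ C
  bdd_dd_dd : ∀ u v, ∃ C, ∀ p, |dd u (dd v f) p| ≤ C

section Derivatives

variable {d : ℕ} {f g : Sp d × ℝ → ℝ}

lemma contDiff_dd (hf : ContDiff ℝ ∞ f) (v : Sp d × ℝ) : ContDiff ℝ ∞ (dd v f) :=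
  (hf.fderiv_right (m := ∞) (by simp)).clm_apply contDiff_const

lemma hasCompactSupport_dd (hf : HasCompactSupport f) (v : Sp d × ℝ) :
    HasCompactSupport (dd v f) :=
  (hf.fderiv ℝ).comp_left (g := fun L : (Sp d × ℝ) →L[ℝ] ℝ => L v) (by simp)

lemma dd_mul (hf : ContDiff ℝ ∞ f) (hg : ContDiff ℝ ∞ g) (v : Sp d × ℝ) :
    dd v (fun p => f p * g p) = fun p => f p * dd v g p + dd v f p * g p := by
  ext p
  unfold dd
  rw [fderiv_fun_mul (hf.differentiable (by simp) p) (hg.differentiable (by simp) p)]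
  simp; ring

lemma dd_add (hf : ContDiff ℝ ∞ f) (hg : ContDiff ℝ ∞ g) (v : Sp d × ℝ) :
    dd v (fun p => f p + g p) = fun p => dd v f p + dd v g p := by
  ext p
  unfold dd
  rw [fderiv_fun_add (hf.differentiable (by simp) p) (hg.differentiable (by simp) p)]
  simp

lemma fderiv_eq_sum_dd (f : Sp d × ℝ → ℝ) (p : Sp d × ℝ) (u : Sp d) (s : ℝ) :
    fderiv ℝ f p (u, s) = ∑ k, u k * dd (eS k) f p + s * dd eT f p := by
  have h : ((u, s) : Sp d × ℝ) = ∑ k, u k • eS k + s • eT := by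
    have hu : u = ∑ k, u k • EuclideanSpace.single k (1 : ℝ) := by
      ext j; simp [Finset.sum_apply, EuclideanSpace.single, Pi.single_apply]
    refine Prod.ext ?_ ?_
    · simp only [eS, eT, Prod.fst_add, Prod.fst_sum, Prod.smul_fst, smul_zero, add_zero]
      exact hu
    · simp [eS, eT, Prod.snd_sum]
  rw [h, map_add, map_sum]
  simp [dd]

lemma exists_bound (hf : Continuous f) (hc : HasCompactSupport f) : ∃ C, ∀ p, |f p| ≤ C :=
  hc.exists_bound_of_continuous hf

lemma SmoothBdd.of_hasCompactSupport (hf : ContDiff ℝ ∞ f) (hc : HasCompactSupport f) :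
    SmoothBdd f where
  smooth := hf
  bdd := exists_bound hf.continuous hc
  bdd_dd v := exists_bound (contDiff_dd hf v).continuous (hasCompactSupport_dd hc v)
  bdd_dd_dd u v := exists_bound (contDiff_dd (contDiff_dd hf v) u).continuous
    (hasCompactSupport_dd (hasCompactSupport_dd hc v) u)

lemma exists_bound_mul (hf : ∃ C, ∀ p, |f p| ≤ C) (hg : ∃ C, ∀ p, |g p| ≤ C) :
    ∃ C, ∀ p, |f p * g p| ≤ C := by
  obtain ⟨C, hC⟩ := hf
  obtain ⟨D, hD⟩ := hg
  refine ⟨C * D, fun p => ?_⟩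
  rw [abs_mul]
  exact mul_le_mul (hC p) (hD p) (abs_nonneg _) ((abs_nonneg _).trans (hC p))

lemma exists_bound_add (hf : ∃ C, ∀ p, |f p| ≤ C) (hg : ∃ C, ∀ p, |g p| ≤ C) :
    ∃ C, ∀ p, |f p + g p| ≤ C := by
  obtain ⟨C, hC⟩ := hf
  obtain ⟨D, hD⟩ := hg
  exact ⟨C + D, fun p => (abs_add_le _ _).trans (add_le_add (hC p) (hD p))⟩

lemma SmoothBdd.mul (hf : SmoothBdd f) (hg : SmoothBdd g) : SmoothBdd (fun p => f p * g p) where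
  smooth := hf.smooth.mul hg.smooth
  bdd := exists_bound_mul hf.bdd hg.bdd
  bdd_dd v := by
    rw [dd_mul hf.smooth hg.smooth]
    exact exists_bound_add (exists_bound_mul hf.bdd (hg.bdd_dd v))
      (exists_bound_mul (hf.bdd_dd v) hg.bdd)
  bdd_dd_dd u v := by
    rw [dd_mul hf.smooth hg.smooth, dd_add (hf.smooth.mul (contDiff_dd hg.smooth v))
      ((contDiff_dd hf.smooth v).mul hg.smooth), dd_mul hf.smooth (contDiff_dd hg.smooth v),
      dd_mul (contDiff_dd hf.smooth v) hg.smooth]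
    exact exists_bound_add
      (exists_bound_add (exists_bound_mul hf.bdd (hg.bdd_dd_dd u v))
        (exists_bound_mul (hf.bdd_dd u) (hg.bdd_dd v)))
      (exists_bound_add (exists_bound_mul (hf.bdd_dd v) (hg.bdd_dd u))
        (exists_bound_mul (hf.bdd_dd_dd u v) hg.bdd))

end Derivatives

lemma Res_const_mul {d : ℕ} {σ lam : ℝ} (c : ℝ) (f : Sp d × ℝ → ℝ) (p : Sp d × ℝ) :
    Res σ lam (fun q => c * f q) p = c * Res σ lam f p :=
  integral_const_mul _ _

section Resolvent

variable {d : ℕ} {σ lam : ℝ} [hl : Fact (0 < lam)] {f g : Sp d × ℝ → ℝ}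

lemma integrable_shift (hf : Continuous f) (hb : ∃ C, ∀ p, |f p| ≤ C) (p : Sp d × ℝ) :
    Integrable (fun w => f (p + shift σ w)) (killedLaw d lam) := by
  obtain ⟨C, hC⟩ := hb
  exact integrable_of_continuous_bdd
    (hf.comp (continuous_const.add (continuous_shift σ))) (fun w => hC _)

lemma Res_eq (hf : Continuous f) (hb : ∃ C, ∀ p, |f p| ≤ C) (p : Sp d × ℝ) :
    Res σ lam f p = ∫ τ in Ioi 0, Real.exp (-lam * τ) *
      ∫ z, f (p + shift σ (τ, z)) ∂(stdGaussian (Sp d)) := by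
  rw [← integral_timeLaw, Res, killedLaw, integral_prod]
  exact integrable_shift hf hb p

lemma Res_add (hf : Continuous f) (hfb : ∃ C, ∀ p, |f p| ≤ C) (hg : Continuous g)
    (hgb : ∃ C, ∀ p, |g p| ≤ C) (p : Sp d × ℝ) :
    Res σ lam (fun q => f q + g q) p = Res σ lam f p + Res σ lam g p :=
  integral_add (integrable_shift hf hfb p) (integrable_shift hg hgb p)

lemma Res_sub (hf : Continuous f) (hfb : ∃ C, ∀ p, |f p| ≤ C) (hg : Continuous g)
    (hgb : ∃ C, ∀ p, |g p| ≤ C) (p : Sp d × ℝ) :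
    Res σ lam (fun q => f q - g q) p = Res σ lam f p - Res σ lam g p :=
  integral_sub (integrable_shift hf hfb p) (integrable_shift hg hgb p)

lemma exists_bound_Res (hb : ∃ C, ∀ p, |f p| ≤ C) : ∃ C, ∀ p, |Res σ lam f p| ≤ C := by
  obtain ⟨C, hC⟩ := hb
  refine ⟨C * (killedLaw d lam).real univ, fun p => ?_⟩
  exact norm_integral_le_of_norm_le_const (μ := killedLaw d lam)
    (f := fun w => f (p + shift σ w)) (.of_forall fun w => hC _)

lemma hasFDerivAt_Res (hf : ContDiff ℝ 1 f) (hc : HasCompactSupport f) (p : Sp d × ℝ) :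
    HasFDerivAt (Res σ lam f) (∫ w, fderiv ℝ f (p + shift σ w) ∂(killedLaw d lam)) p := by
  obtain ⟨C, hC⟩ := (hc.fderiv ℝ).exists_bound_of_continuous (hf.continuous_fderiv one_ne_zero)
  have hs := continuous_shift (d := d) σ
  have hf0 := hf.continuous
  have hf1 := hf.continuous_fderiv one_ne_zero
  refine hasFDerivAt_integral_of_dominated_of_fderiv_le (bound := fun _ => C)
    (F' := fun q w => fderiv ℝ f (q + shift σ w)) Filter.univ_mem
    (.of_forall fun q => by fun_prop) (integrable_shift hf0 (exists_bound hf0 hc) p)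
    (by fun_prop) (.of_forall fun w q _ => hC _) (integrable_const _) (.of_forall fun w q _ => ?_)
  exact ((hf.differentiable one_ne_zero _).hasFDerivAt).comp q
    ((hasFDerivAt_id q).add_const (shift σ w))

lemma dd_Res (hf : ContDiff ℝ 1 f) (hc : HasCompactSupport f) (v : Sp d × ℝ) :
    dd v (Res σ lam f) = Res σ lam (dd v f) := by
  ext p
  obtain ⟨C, hC⟩ := (hc.fderiv ℝ).exists_bound_of_continuous (hf.continuous_fderiv one_ne_zero)
  have hs := continuous_shift (d := d) σ
  have hf1 := hf.continuous_fderiv one_ne_zero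
  rw [dd, (hasFDerivAt_Res hf hc p).fderiv, ContinuousLinearMap.integral_apply]
  · rfl
  · exact Integrable.of_bound (by fun_prop) C (.of_forall fun w => hC _)

/-- The resolvent is convolution of `f` with a finite measure, the law of minus the displacement, so
it inherits smoothness from `f`. -/
lemma contDiff_Res (hf : ContDiff ℝ ∞ f) (hc : HasCompactSupport f) :
    ContDiff ℝ ∞ (Res σ lam f) := by
  have hs := continuous_shift (d := d) σ
  have : Res σ lam f = convolution (fun _ => (1 : ℝ)) f (ContinuousLinearMap.lsmul ℝ ℝ)
      ((killedLaw d lam).map (fun w => - shift σ w)) := by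
    ext p
    rw [convolution_def, integral_map (by fun_prop)
      (by have := hf.continuous; fun_prop)]
    simp [Res]
  rw [this]
  have : IsFiniteMeasure ((killedLaw d lam).map (fun w => - shift σ w)) := inferInstance
  exact hc.contDiff_convolution_right _ (locallyIntegrable_const 1) hf

lemma SmoothBdd.Res (hf : ContDiff ℝ ∞ f) (hc : HasCompactSupport f) :
    SmoothBdd (Res σ lam f) where
  smooth := contDiff_Res hf hc
  bdd := exists_bound_Res (exists_bound hf.continuous hc)
  bdd_dd v := by
    rw [dd_Res (hf.of_le (by simp)) hc]
    exact exists_bound_Res (exists_bound (contDiff_dd hf v).continuous (hasCompactSupport_dd hc v))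
  bdd_dd_dd u v := by
    rw [dd_Res (hf.of_le (by simp)) hc, dd_Res ((contDiff_dd hf v).of_le (by simp))
      (hasCompactSupport_dd hc v)]
    exact exists_bound_Res (exists_bound (contDiff_dd (contDiff_dd hf v) u).continuous
      (hasCompactSupport_dd (hasCompactSupport_dd hc v) u))

end Resolvent

section Semigroup

variable {d : ℕ} {σ : ℝ} {f : Sp d × ℝ → ℝ}

lemma fderiv_comp_shift (hf : ContDiff ℝ 1 f) (p : Sp d × ℝ) (τ : ℝ) (k : Fin d) (z : Sp d) :
    fderiv ℝ (fun z => f (p + shift σ (τ, z))) z (EuclideanSpace.single k 1)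
      = σ * √τ * dd (eS k) f (p + shift σ (τ, z)) := by
  have h1 : HasFDerivAt (fun z : Sp d => p + shift σ (τ, z))
      (((σ * √τ) • ContinuousLinearMap.id ℝ (Sp d)).prod 0) z := by
    have := ((((hasFDerivAt_id (𝕜 := ℝ) z).const_smul (σ * √τ)).prodMk
      (hasFDerivAt_const τ z))).const_add p
    exact this
  have h2 := ((hf.differentiable one_ne_zero (p + shift σ (τ, z))).hasFDerivAt).comp z h1
  have h3 : fderiv ℝ (fun z => f (p + shift σ (τ, z))) z = _ := h2.fderiv
  rw [h3, dd]
  have h4 : (((σ * √τ) • ContinuousLinearMap.id ℝ (Sp d)).prod (0 : Sp d →L[ℝ] ℝ))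
      (EuclideanSpace.single k 1) = (σ * √τ) • eS k := by
    simp [eS]
  rw [ContinuousLinearMap.comp_apply, h4, map_smul, smul_eq_mul]

lemma contDiff_comp_shift {n : ℕ∞} (hf : ContDiff ℝ n f) (p : Sp d × ℝ) (τ : ℝ) :
    ContDiff ℝ n (fun z => f (p + shift σ (τ, z))) := by
  refine hf.comp (contDiff_const.add ?_)
  exact (contDiff_id.const_smul (σ * √τ)).prodMk contDiff_const

/-- Gaussian integration by parts for functions of space-time. -/
lemma integral_shift_mul_coord (hf : ContDiff ℝ 1 f) (k : Fin d) (hb : ∃ C, ∀ p, |f p| ≤ C)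
    (hb' : ∃ C, ∀ p, |dd (eS k) f p| ≤ C) (p : Sp d × ℝ) (τ : ℝ) :
    ∫ z, f (p + shift σ (τ, z)) * z k ∂(stdGaussian (Sp d))
      = σ * √τ * ∫ z, dd (eS k) f (p + shift σ (τ, z)) ∂(stdGaussian (Sp d)) := by
  obtain ⟨C, hC⟩ := hb
  obtain ⟨C', hC'⟩ := hb'
  rw [stein (contDiff_comp_shift hf p τ) k (fun z => hC _) (C' := |σ * √τ| * C')
    (fun z => by
      rw [fderiv_comp_shift hf, abs_mul]
      exact mul_le_mul_of_nonneg_left (hC' _) (abs_nonneg _)), ← integral_const_mul]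
  congr 1 with z
  rw [fderiv_comp_shift hf]

/-- Integration by parts for the resolvent. -/
lemma Res_dd {lam : ℝ} [Fact (0 < lam)] (hσ : 0 < σ) (hf : SmoothBdd f) (k : Fin d)
    (p : Sp d × ℝ) :
    Res σ lam (dd (eS k) f) p = ∫ τ in Ioi 0, Real.exp (-lam * τ) * ((σ * √τ)⁻¹ *
      ∫ z, f (p + shift σ (τ, z)) * z k ∂(stdGaussian (Sp d))) := by
  rw [Res_eq (contDiff_dd hf.smooth _).continuous (hf.bdd_dd _)]
  refine setIntegral_congr_fun measurableSet_Ioi fun τ hτ => ?_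
  have : 0 < σ * √τ := mul_pos hσ (Real.sqrt_pos.2 hτ)
  simp only
  rw [integral_shift_mul_coord (hf.smooth.of_le (by simp)) k hf.bdd (hf.bdd_dd _),
    inv_mul_cancel_left₀ this.ne']

lemma hasDerivAt_shift_comp (hf : ContDiff ℝ 1 f) (p : Sp d × ℝ) (z : Sp d) {τ : ℝ}
    (hτ : 0 < τ) :
    HasDerivAt (fun τ => f (p + shift σ (τ, z)))
      (∑ k, (σ / (2 * √τ)) * (dd (eS k) f (p + shift σ (τ, z)) * z k)
        + dd eT f (p + shift σ (τ, z))) τ := by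
  have h1 : HasDerivAt (fun τ : ℝ => p + shift σ (τ, z)) ((σ * (1 / (2 * √τ))) • z, 1) τ := by
    have := ((((Real.hasDerivAt_sqrt hτ.ne').const_mul σ).smul_const z).prodMk
      (hasDerivAt_id τ)).const_add p
    exact this
  have h2 := ((hf.differentiable one_ne_zero (p + shift σ (τ, z))).hasFDerivAt).comp_hasDerivAt τ h1
  rw [fderiv_eq_sum_dd] at h2
  refine h2.congr_deriv ?_
  rw [one_mul, add_left_inj]
  refine Finset.sum_congr rfl fun k _ => ?_
  simp; ring

/-- Kolmogorov's backward equation. The chain rule gives `∂ₜf + (σ/(2√τ)) z·∇f`, and Gaussian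
integration by parts turns the second term into `(σ²/2) Δf`. -/
lemma hasDerivAt_integral_shift (hf : SmoothBdd f) (p : Sp d × ℝ) {τ : ℝ} (hτ : 0 < τ) :
    HasDerivAt (fun τ => ∫ z, f (p + shift σ (τ, z)) ∂(stdGaussian (Sp d)))
      (∫ z, gen σ f (p + shift σ (τ, z)) ∂(stdGaussian (Sp d))) τ := by
  have hs := continuous_shift (d := d) σ
  have hf0 := hf.smooth.continuous
  have hft : Continuous (dd eT f) := (contDiff_dd hf.smooth eT).continuous
  have hfk : ∀ k : Fin d, Continuous (dd (eS k) f) := fun k =>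
    (contDiff_dd hf.smooth (eS k)).continuous
  have hfkk : ∀ k : Fin d, Continuous (dd (eS k) (dd (eS k) f)) := fun k =>
    (contDiff_dd (contDiff_dd hf.smooth (eS k)) (eS k)).continuous
  obtain ⟨C, hC⟩ := hf.bdd
  obtain ⟨T, hT⟩ := hf.bdd_dd eT
  choose D hD using fun k : Fin d => hf.bdd_dd (eS k)
  choose D2 hD2 using fun k : Fin d => hf.bdd_dd_dd (eS k) (eS k)
  -- Differentiation is dominated on `(τ/2, ∞)`, away from the singularity of `1/√τ` at `0`.
  have key := hasDerivAt_integral_of_dominated_loc_of_deriv_le (μ := stdGaussian (Sp d))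
    (F := fun τ z => f (p + shift σ (τ, z))) (x₀ := τ) (s := Ioi (τ / 2))
    (bound := fun z => ∑ k, (|σ| / (2 * √(τ / 2))) * (D k * |z k|) + T)
    (F' := fun τ z => ∑ k, (σ / (2 * √τ)) * (dd (eS k) f (p + shift σ (τ, z)) * z k)
        + dd eT f (p + shift σ (τ, z)))
    (Ioi_mem_nhds (by linarith)) (.of_forall fun τ => by fun_prop)
    (integrable_of_continuous_bdd (by fun_prop) (fun z => hC _)) (by fun_prop)
    (.of_forall fun z t ht => ?_) ?_ (.of_forall fun z t ht => ?_)
  · refine key.2.congr_deriv ?_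
    have hi : ∀ k : Fin d, Integrable (fun z => dd (eS k) f (p + shift σ (τ, z)) * z k)
        (stdGaussian (Sp d)) := fun k =>
      integrable_mul_coord (by have := hfk k; fun_prop) (fun z => hD k _) k
    have hit : Integrable (fun z => dd eT f (p + shift σ (τ, z))) (stdGaussian (Sp d)) :=
      integrable_of_continuous_bdd (by fun_prop) (fun z => hT _)
    have hikk : ∀ k : Fin d, Integrable (fun z => dd (eS k) (dd (eS k) f) (p + shift σ (τ, z)))
        (stdGaussian (Sp d)) := fun k =>
      integrable_of_continuous_bdd (by have := hfkk k; fun_prop) (fun z => hD2 k _)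
    rw [integral_add (integrable_finsetSum _ fun k _ => (hi k).const_mul _) hit,
      integral_finsetSum _ fun k _ => (hi k).const_mul _]
    simp only [gen]
    rw [integral_add hit ((integrable_finsetSum _ fun k _ => hikk k).const_mul _),
      integral_const_mul, integral_finsetSum _ fun k _ => hikk k, add_comm, Finset.mul_sum]
    congr 1
    refine Finset.sum_congr rfl fun k _ => ?_
    rw [integral_const_mul, integral_shift_mul_coord ((contDiff_dd hf.smooth _).of_le (by simp)) k
      (hf.bdd_dd _) (hf.bdd_dd_dd _ _)]
    have := Real.sqrt_pos.2 hτ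
    field_simp
  · have ht' : τ / 2 < t := ht
    refine (norm_add_le _ _).trans (add_le_add ((norm_sum_le _ _).trans
      (Finset.sum_le_sum fun k _ => ?_)) (hT _))
    rw [Real.norm_eq_abs, abs_mul, abs_mul, abs_div, abs_of_nonneg (by positivity : 0 ≤ 2 * √t)]
    have h0 : 0 < √(τ / 2) := Real.sqrt_pos.2 (by linarith)
    have h1 : √(τ / 2) ≤ √t := Real.sqrt_le_sqrt ht'.le
    have h2 := hD k (p + shift σ (t, z))
    gcongr
  · exact (integrable_finsetSum _ fun k _ =>
      (((integrable_coord k).abs.const_mul _).const_mul _)).add (integrable_const _)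
  · have ht' : τ / 2 < t := ht
    exact hasDerivAt_shift_comp (hf.smooth.of_le (by simp)) p z (by linarith)

lemma continuous_gen (hf : ContDiff ℝ ∞ f) : Continuous (gen σ f) := by
  unfold gen
  have hft : Continuous (dd eT f) := (contDiff_dd hf eT).continuous
  have hfkk : ∀ k : Fin d, Continuous (dd (eS k) (dd (eS k) f)) := fun k =>
    (contDiff_dd (contDiff_dd hf (eS k)) (eS k)).continuous
  fun_prop

lemma exists_bound_sum {ι : Type*} (s : Finset ι) {F : ι → Sp d × ℝ → ℝ}
    (h : ∀ i, ∃ C, ∀ p, |F i p| ≤ C) : ∃ C, ∀ p, |∑ i ∈ s, F i p| ≤ C := by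
  choose C hC using h
  exact ⟨∑ i ∈ s, C i, fun p => (Finset.abs_sum_le_sum_abs _ _).trans
    (Finset.sum_le_sum fun i _ => hC i p)⟩

lemma exists_bound_const_mul (c : ℝ) (h : ∃ C, ∀ p, |f p| ≤ C) : ∃ C, ∀ p, |c * f p| ≤ C :=
  exists_bound_mul (f := fun _ => c) ⟨|c|, fun _ => le_rfl⟩ h

lemma exists_bound_gen (hf : SmoothBdd f) : ∃ C, ∀ p, |gen σ f p| ≤ C :=
  exists_bound_add (hf.bdd_dd _)
    (exists_bound_const_mul _ (exists_bound_sum _ fun _ => hf.bdd_dd_dd _ _))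

/-- The resolvent inverts `λ - (∂ₜ + σ²Δ/2)`. -/
lemma Res_sub_gen {lam : ℝ} [hl : Fact (0 < lam)] (hf : SmoothBdd f) (p : Sp d × ℝ) :
    Res σ lam (fun q => lam * f q - gen σ f q) p = f p := by
  have hs := continuous_shift (d := d) σ
  have hf0 := hf.smooth.continuous
  have hg := continuous_gen (σ := σ) hf.smooth
  obtain ⟨C, hC⟩ := hf.bdd
  have hgb := exists_bound_gen (σ := σ) hf
  have hhc : Continuous fun q => lam * f q - gen σ f q := by fun_prop
  have hhb : ∃ C, ∀ q, |lam * f q - gen σ f q| ≤ C := by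
    obtain ⟨D, hD⟩ := hgb
    refine ⟨|lam| * C + D, fun q => (abs_sub _ _).trans (add_le_add ?_ (hD q))⟩
    rw [abs_mul]
    exact mul_le_mul_of_nonneg_left (hC q) (abs_nonneg _)
  obtain ⟨D, hD⟩ := hgb
  have hig : ∀ τ : ℝ, Integrable (fun z => gen σ f (p + shift σ (τ, z))) (stdGaussian (Sp d)) :=
    fun τ => integrable_of_continuous_bdd (by fun_prop) (fun z => hD _)
  have hif : ∀ τ : ℝ, Integrable (fun z => f (p + shift σ (τ, z))) (stdGaussian (Sp d)) :=
    fun τ => integrable_of_continuous_bdd (by fun_prop) (fun z => hC _)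
  set Φ : ℝ → ℝ := fun τ => ∫ z, f (p + shift σ (τ, z)) ∂(stdGaussian (Sp d)) with hΦ
  have hΦc : Continuous Φ := continuous_of_dominated (bound := fun _ => C)
    (fun τ => by fun_prop) (fun τ => .of_forall fun z => hC _) (integrable_const _)
    (.of_forall fun z => by fun_prop)
  have hΦb : ∀ τ, |Φ τ| ≤ C := fun τ => by
    have := norm_integral_le_of_norm_le_const (μ := stdGaussian (Sp d))
      (f := fun z => f (p + shift σ (τ, z))) (C := C) (.of_forall fun z => hC _)
    simpa using this
  have hexp : Tendsto (fun τ => Real.exp (-lam * τ)) atTop (𝓝 0) :=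
    Real.tendsto_exp_atBot.comp (tendsto_id.const_mul_atTop_of_neg (by linarith [hl.out]))
  have hlim : Tendsto (fun τ => Real.exp (-lam * τ) * Φ τ) atTop (𝓝 0) := by
    refine squeeze_zero_norm (a := fun τ => Real.exp (-lam * τ) * C) (fun τ => ?_)
      (by simpa using hexp.mul_const C)
    rw [norm_mul, Real.norm_of_nonneg (Real.exp_nonneg _)]
    exact mul_le_mul_of_nonneg_left (hΦb τ) (Real.exp_nonneg _)
  -- By the backward equation, `e^{-λτ} Φ(τ)` is minus a primitive of the integrand of the resolvent
  -- in question.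
  have hder : ∀ τ ∈ Ioi (0 : ℝ), HasDerivAt (fun τ => Real.exp (-lam * τ) * Φ τ)
      (-(Real.exp (-lam * τ) *
        ∫ z, (lam * f (p + shift σ (τ, z)) - gen σ f (p + shift σ (τ, z)))
          ∂(stdGaussian (Sp d)))) τ := by
    intro τ hτ
    have h1 : HasDerivAt (fun τ => Real.exp (-lam * τ)) (Real.exp (-lam * τ) * (-lam * 1)) τ :=
      ((hasDerivAt_id τ).const_mul (-lam)).exp
    refine (h1.mul (hasDerivAt_integral_shift hf p hτ)).congr_deriv ?_
    rw [integral_sub ((hif τ).const_mul _) (hig τ), integral_const_mul]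
    ring
  have hint : IntegrableOn (fun τ => -(Real.exp (-lam * τ) *
        ∫ z, (lam * f (p + shift σ (τ, z)) - gen σ f (p + shift σ (τ, z)))
          ∂(stdGaussian (Sp d)))) (Ioi 0) := by
    refine Integrable.neg ?_
    have := (integrable_shift (σ := σ) (lam := lam) hhc hhb p)
    exact integrable_timeLaw_iff.1 this.integral_prod_left
  -- At the endpoint `0` only continuity of `Φ` is used; differentiability is known only for `τ >
  -- 0`.
  have key := integral_Ioi_of_hasDerivAt_of_tendsto (by fun_prop) hder hint hlim
  rw [integral_neg] at key
  rw [Res_eq hhc hhb]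
  have h0 : Φ 0 = f p := by simp [hΦ, shift, Prod.mk_zero_zero]
  rw [neg_eq_iff_eq_neg.1 key, h0]
  simp

/-- `λ - (∂ₜ + σ²Δ/2)` applied to a resolvent. -/
lemma sub_gen_Res {lam : ℝ} [hl : Fact (0 < lam)] (hf : ContDiff ℝ ∞ f)
    (hc : HasCompactSupport f) (p : Sp d × ℝ) :
    lam * Res σ lam f p - gen σ (Res σ lam f) p = f p := by
  have hfb := SmoothBdd.of_hasCompactSupport hf hc
  have hft : Continuous (dd eT f) := (contDiff_dd hf eT).continuous
  have hfkk : ∀ k : Fin d, Continuous (dd (eS k) (dd (eS k) f)) := fun k =>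
    (contDiff_dd (contDiff_dd hf (eS k)) (eS k)).continuous
  -- The resolvent is translation invariant, so it commutes with the constant-coefficient generator.
  have hgen : gen σ (Res σ lam f) p = Res σ lam (gen σ f) p := by
    have h2 : ∀ k : Fin d, dd (eS k) (dd (eS k) (Res σ lam f))
        = Res σ lam (dd (eS k) (dd (eS k) f)) := fun k => by
      rw [dd_Res (hf.of_le (by simp)) hc, dd_Res ((contDiff_dd hf _).of_le (by simp))
        (hasCompactSupport_dd hc _)]
    unfold gen
    rw [Res_add hft (hfb.bdd_dd _) (by fun_prop)
      (exists_bound_const_mul _ (exists_bound_sum _ fun k => hfb.bdd_dd_dd _ _)),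
      Res_const_mul, dd_Res (hf.of_le (by simp)) hc]
    simp_rw [h2]
    congr 2
    exact (integral_finsetSum _ fun k _ => integrable_shift (hfkk k) (hfb.bdd_dd_dd _ _) p).symm
  rw [hgen, ← Res_const_mul, ← Res_sub (by have := hf.continuous; fun_prop)
    (exists_bound_const_mul _ hfb.bdd) (continuous_gen hf) (exists_bound_gen hfb)]
  exact Res_sub_gen hfb p

end Semigroup

end DavieBound

/-! ### Kato bounds, energy bounds and the step of the iteration. -/

namespace DavieBound

open Filter Topology
open scoped ContDiff

/-- The root mean square of `b` at the space-time point reached from `p` after time `τ`. -/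
noncomputable def rms {d : ℕ} (σ : ℝ) (b : Sp d × ℝ → ℝ) (p : Sp d × ℝ) (τ : ℝ) : ℝ :=
  √(∫ z, b (p + shift σ (τ, z)) ^ 2 ∂(stdGaussian (Sp d)))

/-- Smooth compactly supported functions with Kato type bounds of size `β`. -/
structure KatoBound {d : ℕ} (σ lam β : ℝ) (b : Sp d × ℝ → ℝ) : Prop where
  smooth : ContDiff ℝ ∞ b
  compact : HasCompactSupport b
  nonneg : 0 ≤ β
  sq_le : ∀ p, Res σ lam (fun q => b q ^ 2) p ≤ (σ * β) ^ 2
  drift_le : ∀ p, ∫ τ in Ioi 0, Real.exp (-lam * τ) * ((σ * √τ)⁻¹ * rms σ b p τ) ≤ β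

/-- `W` is bounded by `m` and its gradient has resolvent energy at most `n²`. -/
structure EnergyBound {d : ℕ} (σ lam m n : ℝ) (W : Sp d × ℝ → ℝ) : Prop where
  smoothBdd : SmoothBdd W
  nonneg_left : 0 ≤ m
  nonneg_right : 0 ≤ n
  abs_le : ∀ p, |W p| ≤ m
  energy_le : ∀ k p, σ ^ 2 * Res σ lam (fun q => dd (eS k) W q ^ 2) p ≤ n ^ 2

lemma Res_nonneg {d : ℕ} {σ lam : ℝ} {f : Sp d × ℝ → ℝ} (hf : ∀ p, 0 ≤ f p) (p : Sp d × ℝ) :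
    0 ≤ Res σ lam f p :=
  integral_nonneg fun _ => hf _

lemma abs_integral_le_of_abs_le {α : Type*} [MeasurableSpace α] {μ : Measure α} {f g : α → ℝ}
    (hg : Integrable g μ) (h : ∀ᵐ a ∂μ, |f a| ≤ g a) : |∫ a, f a ∂μ| ≤ ∫ a, g a ∂μ :=
  norm_integral_le_of_norm_le (f := f) hg h

lemma integrableOn_exp_mul_inv_sqrt {lam : ℝ} (hl : 0 < lam) (σ : ℝ) :
    IntegrableOn (fun τ => Real.exp (-lam * τ) * (σ * √τ)⁻¹) (Ioi 0) := by
  have h := (integrableOn_rpow_mul_exp_neg_mul_rpow (s := -(1 / 2)) (p := 1) (b := lam)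
    (by norm_num) one_pos hl).const_mul σ⁻¹
  refine IntegrableOn.congr_fun (f := fun τ => σ⁻¹ * (τ ^ (-(1 / 2) : ℝ) *
    Real.exp (-lam * τ ^ (1 : ℝ)))) h (fun τ hτ => ?_) measurableSet_Ioi
  have hτ' : (0 : ℝ) < τ := hτ
  simp only [Real.rpow_one]
  rw [Real.rpow_neg hτ'.le, ← Real.sqrt_eq_rpow, mul_inv]
  ring

section

variable {d : ℕ} {σ lam : ℝ} {b : Sp d × ℝ → ℝ}

lemma continuous_rms (hb : Continuous b) (hbb : ∃ C, ∀ p, |b p| ≤ C) (p : Sp d × ℝ) :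
    Continuous (rms σ b p) := by
  have hs := continuous_shift (d := d) σ
  obtain ⟨C, hC⟩ := hbb
  refine (continuous_of_dominated (bound := fun _ => C ^ 2)
    (fun τ => by fun_prop) (fun τ => .of_forall fun z => ?_) (integrable_const _)
    (.of_forall fun z => by fun_prop)).sqrt
  rw [norm_pow]
  exact pow_le_pow_left₀ (norm_nonneg _) (hC _) 2

lemma rms_le {C : ℝ} (hC : ∀ p, |b p| ≤ C) (p : Sp d × ℝ) (τ : ℝ) : rms σ b p τ ≤ C := by
  have h0 : 0 ≤ C := (abs_nonneg _).trans (hC p)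
  rw [rms, Real.sqrt_le_left h0]
  have := norm_integral_le_of_norm_le_const (μ := stdGaussian (Sp d))
    (f := fun z => b (p + shift σ (τ, z)) ^ 2) (C := C ^ 2)
    (.of_forall fun z => by
      rw [norm_pow]; exact pow_le_pow_left₀ (norm_nonneg _) (hC _) 2)
  simpa using (le_abs_self _).trans this

lemma integrableOn_drift [hl : Fact (0 < lam)] (hb : Continuous b) (hbb : ∃ C, ∀ p, |b p| ≤ C)
    (p : Sp d × ℝ) :
    IntegrableOn (fun τ => Real.exp (-lam * τ) * ((σ * √τ)⁻¹ * rms σ b p τ)) (Ioi 0) := by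
  have hc := continuous_rms (σ := σ) hb hbb p
  obtain ⟨C, hC⟩ := hbb
  refine ((integrableOn_exp_mul_inv_sqrt hl.out σ).mul_bdd (c := C) (g := rms σ b p)
    hc.aestronglyMeasurable (.of_forall fun τ => ?_)).congr (.of_forall fun τ => ?_)
  · rw [Real.norm_of_nonneg (show 0 ≤ rms σ b p τ from Real.sqrt_nonneg _)]
    exact rms_le hC p τ
  · simp only; ring

variable [Fact (0 < lam)] {β : ℝ}

/-- Integration by parts moves a spatial derivative from `b Q` to the heat kernel. -/
lemma KatoBound.abs_Res_dd_le (hσ : 0 < σ) (hb : KatoBound σ lam β b) {Q : Sp d × ℝ → ℝ}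
    (hQ : SmoothBdd Q) {q : ℝ} (hq : ∀ p, |Q p| ≤ q) (k : Fin d) (p : Sp d × ℝ) :
    |Res σ lam (dd (eS k) (fun x => b x * Q x)) p| ≤ β * q := by
  have hs := continuous_shift (d := d) σ
  have hbs := SmoothBdd.of_hasCompactSupport hb.smooth hb.compact
  have hbc := hb.smooth.continuous
  have hQc := hQ.smooth.continuous
  have hq0 : 0 ≤ q := (abs_nonneg _).trans (hq p)
  obtain ⟨C, hC⟩ := hbs.bdd
  rw [Res_dd hσ (hbs.mul hQ) k p]
  have hint := (integrableOn_drift (σ := σ) (lam := lam) hbc hbs.bdd p).mul_const q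
  calc |∫ τ in Ioi 0, Real.exp (-lam * τ) * ((σ * √τ)⁻¹ *
          ∫ z, b (p + shift σ (τ, z)) * Q (p + shift σ (τ, z)) * z k ∂(stdGaussian (Sp d)))|
      ≤ ∫ τ in Ioi 0, Real.exp (-lam * τ) * ((σ * √τ)⁻¹ * rms σ b p τ) * q := by
        refine abs_integral_le_of_abs_le hint ?_
        refine (ae_restrict_mem measurableSet_Ioi).mono fun τ _ => ?_
        have h1 : |∫ z, b (p + shift σ (τ, z)) * Q (p + shift σ (τ, z)) * z k
            ∂(stdGaussian (Sp d))| ≤ rms σ b p τ * q := by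
          calc |∫ z, b (p + shift σ (τ, z)) * Q (p + shift σ (τ, z)) * z k
                ∂(stdGaussian (Sp d))|
              ≤ ∫ z, (|b (p + shift σ (τ, z))| * |z k|) * q ∂(stdGaussian (Sp d)) := by
                refine abs_integral_le_of_abs_le ((integrable_mul_coord
                  (f := fun z => |b (p + shift σ (τ, z))|) (C := C) (by fun_prop)
                  (fun z => by simpa using hC _) k).abs.congr
                    (.of_forall fun z => by simp [abs_mul]) |>.mul_const q)
                  (.of_forall fun z => ?_)
                rw [abs_mul, abs_mul, mul_right_comm]
                exact mul_le_mul_of_nonneg_left (hq _) (by positivity)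
            _ ≤ _ := by
                rw [integral_mul_const]
                exact mul_le_mul_of_nonneg_right (integral_abs_mul_coord_le
                  (f := fun z => b (p + shift σ (τ, z))) (by fun_prop) (fun z => hC _) k) hq0
        rw [abs_mul, abs_mul, abs_of_nonneg (Real.exp_nonneg _),
          abs_of_nonneg (by positivity), mul_assoc, mul_assoc]
        gcongr
    _ ≤ β * q := by
        rw [integral_mul_const]
        exact mul_le_mul_of_nonneg_right (hb.drift_le p) hq0

/-- Cauchy–Schwarz for the resolvent. -/
lemma KatoBound.abs_Res_mul_le (hσ : 0 < σ) (hb : KatoBound σ lam β b) {Q D : Sp d × ℝ → ℝ}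
    {q : ℝ} (hq : ∀ p, |Q p| ≤ q) (hDc : Continuous D)
    (hDb : ∃ C, ∀ p, |D p| ≤ C) {n : ℝ} (hn : 0 ≤ n) (p : Sp d × ℝ)
    (hD : σ ^ 2 * Res σ lam (fun x => D x ^ 2) p ≤ n ^ 2) :
    |Res σ lam (fun x => b x * Q x * D x) p| ≤ β * (q * n) := by
  have hs := continuous_shift (d := d) σ
  have hbc := hb.smooth.continuous
  have hq0 : 0 ≤ q := (abs_nonneg _).trans (hq p)
  obtain ⟨C, hC⟩ := exists_bound hbc hb.compact
  obtain ⟨C', hC'⟩ := hDb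
  have hbm : MemLp (fun w => b (p + shift σ w)) 2 (killedLaw d lam) :=
    MemLp.of_bound (by fun_prop) C (.of_forall fun w => hC _)
  have hDm : MemLp (fun w => D (p + shift σ w)) 2 (killedLaw d lam) :=
    MemLp.of_bound (by fun_prop) C' (.of_forall fun w => hC' _)
  have h := integral_mul_norm_le_Lp_mul_Lq (μ := killedLaw d lam)
    (f := fun w => b (p + shift σ w)) (g := fun w => D (p + shift σ w))
    Real.HolderConjugate.two_two (by simpa using hbm) (by simpa using hDm)
  simp only [Real.norm_eq_abs, Real.rpow_ofNat, sq_abs, ← Real.sqrt_eq_rpow] at h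
  have h1 : √(Res σ lam (fun x => b x ^ 2) p) ≤ σ * β :=
    Real.sqrt_le_iff.2 ⟨mul_nonneg hσ.le hb.nonneg, hb.sq_le p⟩
  have h2 : √(Res σ lam (fun x => D x ^ 2) p) ≤ n / σ := by
    refine Real.sqrt_le_iff.2 ⟨by positivity, ?_⟩
    rw [div_pow, le_div_iff₀ (by positivity), mul_comm]
    exact hD
  have h3 : ∫ w, |b (p + shift σ w)| * |D (p + shift σ w)| ∂(killedLaw d lam) ≤ β * n := by
    refine h.trans ((mul_le_mul h1 h2 (Real.sqrt_nonneg _)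
      (mul_nonneg hσ.le hb.nonneg)).trans_eq ?_)
    field_simp
  calc |∫ w, b (p + shift σ w) * Q (p + shift σ w) * D (p + shift σ w) ∂(killedLaw d lam)|
      ≤ ∫ w, (|b (p + shift σ w)| * |D (p + shift σ w)|) * q ∂(killedLaw d lam) := by
        refine abs_integral_le_of_abs_le ((integrable_of_continuous_bdd (C := C * C')
          (f := fun w => |b (p + shift σ w)| * |D (p + shift σ w)|)
          (by fun_prop) fun w => ?_).mul_const q) (.of_forall fun w => ?_)
        · rw [abs_of_nonneg (by positivity)]
          exact mul_le_mul (hC _) (hC' _) (abs_nonneg _) ((abs_nonneg _).trans (hC p))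
        · rw [abs_mul, abs_mul, mul_right_comm]
          exact mul_le_mul_of_nonneg_left (hq _) (by positivity)
    _ ≤ (β * n) * q := by
        rw [integral_mul_const]
        exact mul_le_mul_of_nonneg_right h3 hq0
    _ = _ := by ring

lemma exists_bound_sq {f : Sp d × ℝ → ℝ} (hf : ∃ C, ∀ p, |f p| ≤ C) :
    ∃ C, ∀ p, |f p ^ 2| ≤ C := by
  simpa only [sq] using exists_bound_mul hf hf

/-- The energy inequality for resolvents. -/
lemma energy_Res_le {g : Sp d × ℝ → ℝ} (hg : ContDiff ℝ ∞ g) (hc : HasCompactSupport g)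
    (k : Fin d) (p : Sp d × ℝ) :
    σ ^ 2 * Res σ lam (fun q => dd (eS k) (Res σ lam g) q ^ 2) p
      ≤ 2 * Res σ lam (fun q => Res σ lam g q * g q) p := by
  have hl : 0 < lam := Fact.out
  set V := Res σ lam g with hV
  have hVs : SmoothBdd V := SmoothBdd.Res hg hc
  have hVc := hVs.smooth.continuous
  have hgc := hg.continuous
  have hVd : ∀ v, Continuous (dd v V) := fun v => (contDiff_dd hVs.smooth v).continuous
  have hgb := exists_bound hgc hc
  -- The carré du champ identity `gen (V²) = 2V gen V + σ²|∇V|²`, combined with `λV - gen V = g`.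
  have hgen : ∀ q, lam * (V q * V q) - gen σ (fun x => V x * V x) q
      = 2 * (V q * g q) - (lam * V q ^ 2 + σ ^ 2 * ∑ j, dd (eS j) V q ^ 2) := by
    intro q
    have h1 : ∀ v, dd v (fun x => V x * V x) = fun x => V x * dd v V x + dd v V x * V x :=
      fun v => dd_mul hVs.smooth hVs.smooth v
    have h2 : ∀ v, dd v (dd v (fun x => V x * V x))
        = fun x => 2 * (V x * dd v (dd v V) x) + 2 * dd v V x ^ 2 := fun v => by
      have hv := contDiff_dd hVs.smooth v
      rw [h1, dd_add (hVs.smooth.mul hv) (hv.mul hVs.smooth), dd_mul hVs.smooth hv,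
        dd_mul hv hVs.smooth]
      ext x; ring
    have h3 := sub_gen_Res (σ := σ) (lam := lam) hg hc q
    rw [← hV] at h3
    rw [← h3]
    simp only [gen, h2, Finset.sum_add_distrib, ← Finset.mul_sum]
    rw [h1]
    ring
  have h := Res_sub_gen (σ := σ) (lam := lam) (hVs.mul hVs) p
  simp_rw [hgen] at h
  have hsumc : Continuous fun q => ∑ j, dd (eS j) V q ^ 2 := by
    have := fun j : Fin d => hVd (eS j)
    fun_prop
  have hsumb : ∃ C, ∀ q, |∑ j, dd (eS j) V q ^ 2| ≤ C :=
    exists_bound_sum _ fun j => exists_bound_sq (hVs.bdd_dd (eS j))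
  rw [Res_sub (by fun_prop) (exists_bound_const_mul _ (exists_bound_mul hVs.bdd hgb))
    (by fun_prop) (exists_bound_add (exists_bound_const_mul _ (exists_bound_sq hVs.bdd))
      (exists_bound_const_mul _ hsumb)),
    Res_add (by fun_prop) (exists_bound_const_mul _ (exists_bound_sq hVs.bdd))
      (by fun_prop) (exists_bound_const_mul _ hsumb), Res_const_mul, Res_const_mul,
    Res_const_mul] at h
  have h4 : 0 ≤ lam * Res σ lam (fun q => V q ^ 2) p :=
    mul_nonneg hl.le (Res_nonneg (fun q => sq_nonneg _) p)
  have h5 : Res σ lam (fun q => dd (eS k) V q ^ 2) p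
      ≤ Res σ lam (fun q => ∑ j, dd (eS j) V q ^ 2) p := by
    refine integral_mono (integrable_shift ((hVd _).pow 2) (exists_bound_sq (hVs.bdd_dd _)) p)
      (integrable_shift hsumc hsumb p) fun w => ?_
    exact Finset.single_le_sum (f := fun j => dd (eS j) V (p + shift σ w) ^ 2)
      (fun j _ => sq_nonneg _) (Finset.mem_univ k)
  have h6 := mul_le_mul_of_nonneg_left h5 (sq_nonneg σ)
  -- The discarded terms `V(p)²` and `λ Res (V²)` both have the favourable sign.
  nlinarith [mul_self_nonneg (V p)]

/-- One step of the iteration: the resolvent of `(∂ₖ b) W` inherits bounds from `W`. -/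
theorem KatoBound.energyBound_step (hσ : 0 < σ) (hb : KatoBound σ lam β b) {m n : ℝ}
    {W : Sp d × ℝ → ℝ} (hW : EnergyBound σ lam m n W) (k : Fin d) :
    EnergyBound σ lam (β * (m + n)) (3 * (β * (m + n)))
      (Res σ lam (fun q => dd (eS k) b q * W q)) := by
  have hm := hW.nonneg_left
  have hn := hW.nonneg_right
  have hβ := hb.nonneg
  have hbs := SmoothBdd.of_hasCompactSupport hb.smooth hb.compact
  have hWs := hW.smoothBdd
  have hbd := contDiff_dd hb.smooth (eS k)
  have hbdc := hasCompactSupport_dd hb.compact (eS k)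
  have hbd0 := hbd.continuous
  have hb0 := hb.smooth.continuous
  have hW0 := hWs.smooth.continuous
  have hW1 := (contDiff_dd hWs.smooth (eS k)).continuous
  have hgs : ContDiff ℝ ∞ (fun q => dd (eS k) b q * W q) := hbd.mul hWs.smooth
  have hgc : HasCompactSupport (fun q => dd (eS k) b q * W q) := hbdc.mul_right
  set V := Res σ lam (fun q => dd (eS k) b q * W q) with hV
  have hVs : SmoothBdd V := SmoothBdd.Res hgs hgc
  have hV0 := hVs.smooth.continuous
  have hV1 : ∀ j, Continuous (dd (eS j) V) := fun j => (contDiff_dd hVs.smooth _).continuous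
  have hVM : ∀ p, |V p| ≤ β * (m + n) := by
    intro p
    -- The product rule removes the derivative from `b`. The factor `1` puts the second term in the
    -- form of `abs_Res_mul_le`.
    have h1 : V p = Res σ lam (dd (eS k) (fun x => b x * W x)) p
        - Res σ lam (fun x => b x * 1 * dd (eS k) W x) p := by
      rw [dd_mul hb.smooth hWs.smooth, ← Res_sub (by fun_prop)
        (exists_bound_add (exists_bound_mul hbs.bdd (hWs.bdd_dd _))
          (exists_bound_mul (hbs.bdd_dd _) hWs.bdd)) (by fun_prop)
        (exists_bound_mul (exists_bound_mul hbs.bdd ⟨1, by simp⟩) (hWs.bdd_dd _))]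
      rw [hV]
      congr 1 with q
      ring
    have h2 := hb.abs_Res_dd_le hσ hWs hW.abs_le k p
    have h3 := hb.abs_Res_mul_le hσ (Q := fun _ => 1) (q := 1) (by simp)
      hW1 (hWs.bdd_dd _) hn p (hW.energy_le k p)
    rw [h1]
    refine (abs_sub _ _).trans ((add_le_add h2 h3).trans_eq ?_)
    ring
  have hM : 0 ≤ β * (m + n) := by positivity
  refine ⟨hVs, hM, by positivity, hVM, ?_⟩
  have : Nonempty (Fin d) := ⟨k⟩
  -- The energy in direction `j` will be bounded through the energy in direction `k`, so the
  -- inequality closes on the supremum. That supremum is finite a priori since `V` has bounded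
  -- derivatives.
  set s := ⨆ x : Fin d × (Sp d × ℝ), σ ^ 2 * Res σ lam (fun q => dd (eS x.1) V q ^ 2) x.2 with hs
  have hbdd : BddAbove (range fun x : Fin d × (Sp d × ℝ) =>
      σ ^ 2 * Res σ lam (fun q => dd (eS x.1) V q ^ 2) x.2) := by
    choose C hC using fun j : Fin d =>
      exists_bound_Res (σ := σ) (lam := lam) (exists_bound_sq (hVs.bdd_dd (eS j)))
    refine ⟨σ ^ 2 * ∑ j, |C j|, ?_⟩
    rintro _ ⟨x, rfl⟩
    refine mul_le_mul_of_nonneg_left ?_ (sq_nonneg σ)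
    refine ((le_abs_self _).trans (hC x.1 x.2)).trans ((le_abs_self _).trans ?_)
    exact Finset.single_le_sum (f := fun j => |C j|) (fun j _ => abs_nonneg _) (Finset.mem_univ _)
  have hle : ∀ j p, σ ^ 2 * Res σ lam (fun q => dd (eS j) V q ^ 2) p ≤ s := fun j p =>
    le_ciSup hbdd (j, p)
  have hs0 : 0 ≤ s := le_trans (mul_nonneg (sq_nonneg σ) (Res_nonneg (fun q => sq_nonneg _) 0))
    (hle k 0)
  have hkey : s ≤ 2 * (β * (m + n) * (β * (m + n)) + β * (m + n) * √s) := by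
    refine ciSup_le fun x => ?_
    obtain ⟨j, p⟩ := x
    refine (energy_Res_le hgs hgc j p).trans ?_
    rw [← hV]
    -- The product rule for `b·(VW)`: the term `bW ∂V` brings in the unknown energy through `√s`,
    -- the other two are already controlled.
    have h1 : Res σ lam (fun q => V q * (dd (eS k) b q * W q)) p
        = Res σ lam (dd (eS k) (fun x => b x * (V x * W x))) p
        - (Res σ lam (fun x => b x * W x * dd (eS k) V x) p
          + Res σ lam (fun x => b x * V x * dd (eS k) W x) p) := by
      have hk := hV1 k
      have e1 := exists_bound_mul (exists_bound_mul hbs.bdd hWs.bdd) (hVs.bdd_dd (eS k))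
      have e2 := exists_bound_mul (exists_bound_mul hbs.bdd hVs.bdd) (hWs.bdd_dd (eS k))
      have e3 := (hbs.mul (hVs.mul hWs)).bdd_dd (eS k)
      rw [← Res_add (by fun_prop) e1 (by fun_prop) e2, ← Res_sub
        (contDiff_dd (hbs.mul (hVs.mul hWs)).smooth (eS k)).continuous e3 (by fun_prop)
        (exists_bound_add e1 e2)]
      rw [dd_mul hb.smooth (hVs.mul hWs).smooth, dd_mul hVs.smooth hWs.smooth]
      congr 1 with q
      ring
    have h2 := hb.abs_Res_dd_le hσ (hVs.mul hWs) (q := β * (m + n) * m) (fun x => by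
      rw [abs_mul]
      exact mul_le_mul (hVM x) (hW.abs_le x) (abs_nonneg _) hM) k p
    have h3 := hb.abs_Res_mul_le hσ hW.abs_le (hV1 k) (hVs.bdd_dd _) (Real.sqrt_nonneg s) p
      (by rw [Real.sq_sqrt hs0]; exact hle k p)
    have h4 := hb.abs_Res_mul_le hσ hVM hW1 (hWs.bdd_dd _) hn p (hW.energy_le k p)
    rw [h1]
    have h5 : β * (m * √s) ≤ β * (m + n) * √s := by
      have : 0 ≤ β * n * √s := by positivity
      nlinarith
    linarith [abs_le.1 h2, abs_le.1 h3, abs_le.1 h4]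
  intro j p
  refine (hle j p).trans ?_
  have hsq := Real.sq_sqrt hs0
  have hsn := Real.sqrt_nonneg s
  -- With `M = β(m+n)`, the inequality `s ≤ 2M² + 2M√s` gives `√s ≤ (1+√3)M`, and `3` is a
  -- convenient upper bound.
  have : √s ≤ 3 * (β * (m + n)) := by
    by_contra hcon
    push Not at hcon
    nlinarith
  rw [← hsq]
  exact pow_le_pow_left₀ hsn this 2

end

end DavieBound

/-! ### Kato bounds from the mixed norm. -/

namespace DavieBound

open Filter Topology
open scoped ContDiff

/-- The constant in the `L^κ` norm of `τ^{-γ} e^{-μτ}` on `(0, ∞)`. -/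
noncomputable def gammaConst (γ κ : ℝ) : ℝ :=
  ((1 / κ) ^ (1 - γ * κ) * Real.Gamma (1 - γ * κ)) ^ (1 / κ)

lemma gammaConst_nonneg {γ κ : ℝ} (hκ : 0 < κ) (hγ : γ * κ < 1) : 0 ≤ gammaConst γ κ := by
  have := Real.Gamma_pos_of_pos (sub_pos.2 hγ)
  unfold gammaConst
  positivity

/-- A Gamma integral, convergent at `0` because `γκ < 1`. Its scaling in `μ` is the source of the
power `λ^{-δ₁}`. -/
lemma eLpNorm_rpow_mul_exp {γ μ : ℝ} {κ : ℝ≥0∞} (h0 : κ ≠ 0) (htop : κ ≠ ⊤) (hμ : 0 < μ)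
    (hγ : γ * κ.toReal < 1) :
    eLpNorm (fun τ : ℝ => τ ^ (-γ) * Real.exp (-μ * τ)) κ (volume.restrict (Ioi 0))
      = ENNReal.ofReal (gammaConst γ κ.toReal * μ ^ (γ - (κ⁻¹).toReal)) := by
  have hκ := ENNReal.toReal_pos h0 htop
  set k := κ.toReal with hk
  have hm : AEStronglyMeasurable (fun τ : ℝ => τ ^ (-γ) * Real.exp (-μ * τ))
      (volume.restrict (Ioi 0)) := by
    refine Measurable.aestronglyMeasurable ?_
    fun_prop
  have hpow : ∀ τ ∈ Ioi (0 : ℝ), ‖τ ^ (-γ) * Real.exp (-μ * τ)‖ ^ k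
      = τ ^ ((1 - γ * k) - 1) * Real.exp (-((μ * k) * τ)) := by
    intro τ hτ
    have hτ' : (0 : ℝ) < τ := hτ
    rw [Real.norm_of_nonneg (by positivity), Real.mul_rpow (by positivity) (by positivity),
      ← Real.rpow_mul hτ'.le, ← Real.exp_mul]
    ring_nf
  have hμk : 0 < μ * k := mul_pos hμ hκ
  have hint : IntegrableOn (fun τ : ℝ => ‖τ ^ (-γ) * Real.exp (-μ * τ)‖ ^ k) (Ioi 0) := by
    refine IntegrableOn.congr_fun (f := fun τ : ℝ => τ ^ ((1 - γ * k) - 1) *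
      Real.exp (-(μ * k) * τ ^ (1 : ℝ))) (integrableOn_rpow_mul_exp_neg_mul_rpow (by linarith)
        one_pos hμk) (fun τ hτ => ?_) measurableSet_Ioi
    rw [hpow τ hτ]
    simp
  have hmem : MemLp (fun τ : ℝ => τ ^ (-γ) * Real.exp (-μ * τ)) κ (volume.restrict (Ioi 0)) :=
    (integrable_norm_rpow_iff hm h0 htop).1 hint
  rw [hmem.eLpNorm_eq_integral_rpow_norm h0 htop, ← hk,
    setIntegral_congr_fun measurableSet_Ioi hpow,
    Real.integral_rpow_mul_exp_neg_mul_Ioi (by linarith) hμk, gammaConst]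
  have hG := Real.Gamma_pos_of_pos (sub_pos.2 hγ)
  congr 1
  have h1 : (1 / (μ * k)) ^ (1 - γ * k) = μ ^ (-(1 - γ * k)) * (1 / k) ^ (1 - γ * k) := by
    rw [Real.rpow_neg hμ.le, ← Real.inv_rpow hμ.le, ← Real.mul_rpow (by positivity) (by positivity)]
    congr 1
    field_simp
  have h2 : -(1 - γ * k) * (1 / k) = γ - (κ⁻¹).toReal := by
    rw [ENNReal.toReal_inv, ← hk]
    field_simp
    ring
  rw [h1, mul_assoc, Real.mul_rpow (by positivity) (by positivity), ← Real.rpow_mul hμ.le,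
    ← one_div,
    h2, mul_comm]

lemma eLpNorm_comp_add_left_le {q : ℝ≥0∞} {H : ℝ → ℝ} (hH : AEStronglyMeasurable H volume)
    (s : ℝ) :
    eLpNorm (fun τ => H (s + τ)) q (volume.restrict (Ioi 0)) ≤ eLpNorm H q volume :=
  (eLpNorm_mono_measure _ Measure.restrict_le_self).trans_eq
    (eLpNorm_comp_measurePreserving hH (measurePreserving_add_left volume s))

/-- Hölder's inequality in time, with a power weight and exponential killing. -/
lemma eLpNorm_weight_mul_le {q κ e : ℝ≥0∞} [ENNReal.HolderTriple κ q e] {H : ℝ → ℝ}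
    (hH : AEStronglyMeasurable H volume) (s : ℝ) {γ μ : ℝ} (h0 : κ ≠ 0) (htop : κ ≠ ⊤)
    (hμ : 0 < μ) (hγ : γ * κ.toReal < 1) :
    eLpNorm (fun τ : ℝ => τ ^ (-γ) * Real.exp (-μ * τ) * H (s + τ)) e (volume.restrict (Ioi 0))
      ≤ ENNReal.ofReal (gammaConst γ κ.toReal * μ ^ (γ - (κ⁻¹).toReal)) * eLpNorm H q volume := by
  have hm : AEStronglyMeasurable (fun τ : ℝ => τ ^ (-γ) * Real.exp (-μ * τ))
      (volume.restrict (Ioi 0)) := by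
    refine Measurable.aestronglyMeasurable ?_
    fun_prop
  have hH' : AEStronglyMeasurable (fun τ => H (s + τ)) (volume.restrict (Ioi (0 : ℝ))) :=
    (hH.comp_measurePreserving (measurePreserving_add_left volume s)).restrict
  rw [← eLpNorm_rpow_mul_exp h0 htop hμ hγ]
  refine (eLpNorm_smul_le_mul_eLpNorm (p := κ) (q := q) hH' hm).trans ?_
  gcongr
  exact eLpNorm_comp_add_left_le hH s

/-- The Gaussian average bound on one time slice, at spatial scale `σ√τ`. A majorant `H` of the
slice norms suffices, so their own measurability in time is not needed. -/
lemma rms_le_of_eLpNorm_le {d : ℕ} {r : ℝ≥0∞} (hr : 2 ≤ r) {b : Sp d × ℝ → ℝ}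
    (hb : Continuous b) (hbb : ∃ C, ∀ p, |b p| ≤ C) {H : ℝ → ℝ} (hH0 : ∀ s, 0 ≤ H s)
    (hH : ∀ s, eLpNorm (fun x => b (x, s)) r volume ≤ ENNReal.ofReal (H s)) {σ : ℝ} (hσ : 0 < σ)
    (p : Sp d × ℝ) {τ : ℝ} (hτ : 0 < τ) :
    rms σ b p τ ≤ (gaussConst d r).toReal * (σ * √τ) ^ (-dimRatio d r) * H (p.2 + τ) := by
  have hs := continuous_shift (d := d) σ
  obtain ⟨C, hC⟩ := hbb
  have hc : 0 < σ * √τ := mul_pos hσ (Real.sqrt_pos.2 hτ)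
  have h := lintegral_sq_comp_affine_le hr (f := fun x => b (x, p.2 + τ)) (by fun_prop) p.1 hc
  have hR : 0 ≤ (gaussConst d r).toReal * (σ * √τ) ^ (-dimRatio d r) * H (p.2 + τ) := by
    have := hH0 (p.2 + τ)
    positivity
  refine Real.sqrt_le_iff.2 ⟨hR, ?_⟩
  rw [← ENNReal.ofReal_le_ofReal_iff (by positivity), ofReal_integral_eq_lintegral_ofReal
    (integrable_of_continuous_bdd (C := C ^ 2) (by fun_prop) (fun z => by
      rw [abs_pow]; exact pow_le_pow_left₀ (abs_nonneg _) (hC _) 2))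
    (.of_forall fun z => sq_nonneg _)]
  calc ∫⁻ z, ENNReal.ofReal (b (p + shift σ (τ, z)) ^ 2) ∂(stdGaussian (Sp d))
      = ∫⁻ z, ‖b (p.1 + (σ * √τ) • z, p.2 + τ)‖ₑ ^ 2 ∂(stdGaussian (Sp d)) := by
        congr 1 with z
        rw [← sq_abs, ENNReal.ofReal_pow (abs_nonneg _), Real.enorm_eq_ofReal_abs]
        rfl
    _ ≤ _ := h
    _ ≤ _ := by
        rw [ENNReal.ofReal_pow hR, ENNReal.ofReal_mul (by positivity),
          ENNReal.ofReal_mul (by positivity), ENNReal.ofReal_toReal (gaussConst_lt_top d r).ne]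
        gcongr
        exact hH _

lemma rpow_mul_sqrt {σ τ : ℝ} (hσ : 0 < σ) (hτ : 0 < τ) (e : ℝ) :
    (σ * √τ) ^ (-e) = σ ^ (-e) * τ ^ (-(e / 2)) := by
  rw [Real.mul_rpow hσ.le (Real.sqrt_nonneg _), Real.sqrt_eq_rpow, ← Real.rpow_mul hτ.le]
  ring_nf

lemma Res_sq_eq {d : ℕ} {σ lam : ℝ} [Fact (0 < lam)] {b : Sp d × ℝ → ℝ} (hb : Continuous b)
    (hbb : ∃ C, ∀ p, |b p| ≤ C) (p : Sp d × ℝ) :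
    Res σ lam (fun q => b q ^ 2) p
      = ∫ τ in Ioi 0, Real.exp (-lam * τ) * rms σ b p τ ^ 2 := by
  rw [Res_eq (by fun_prop) (exists_bound_sq hbb)]
  congr 1 with τ
  rw [rms, Real.sq_sqrt (integral_nonneg fun _ => sq_nonneg _)]

/-- Comparing lower integrals avoids proving beforehand that `g` is integrable. -/
lemma setIntegral_le_of_lintegral_le {f g : ℝ → ℝ} {c : ℝ} (hf : Continuous f ∨ Measurable f)
    (hf0 : ∀ τ ∈ Ioi (0 : ℝ), 0 ≤ f τ) (hfg : ∀ τ ∈ Ioi (0 : ℝ), f τ ≤ g τ) (hc : 0 ≤ c)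
    (h : ∫⁻ τ in Ioi 0, ENNReal.ofReal (g τ) ≤ ENNReal.ofReal c) : ∫ τ in Ioi 0, f τ ≤ c := by
  have hfm : Measurable f := hf.elim Continuous.measurable id
  rw [integral_eq_lintegral_of_nonneg_ae
    ((ae_restrict_mem measurableSet_Ioi).mono hf0) hfm.aestronglyMeasurable]
  refine ENNReal.toReal_le_of_le_ofReal hc (le_trans ?_ h)
  exact setLIntegral_mono' measurableSet_Ioi fun τ hτ => ENNReal.ofReal_le_ofReal (hfg τ hτ)

/-- The constant in the Kato bounds of functions in `L^{r,q}`. -/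
noncomputable def katoConst (d : ℕ) (r q : ℝ≥0∞) : ℝ :=
  (gaussConst d r).toReal *
    (gammaConst (dimRatio d r / 2) ((2⁻¹ - q⁻¹)⁻¹).toReal * (1 / 2) ^ (-delta1 d r q)
      + gammaConst ((1 + dimRatio d r) / 2) ((1 - q⁻¹)⁻¹).toReal)

/-- The exponent `κ` with `1/κ = e - 1/q` is the Hölder partner of `q`, and `γκ < 1` says `γ < e -
1/q`. In both uses, `e = 1/2` with `γ = d/(2r)` and `e = 1` with `γ = (1 + d/r)/2`, the gap is
exactly `δ₁`. -/
lemma exponent_conditions {q e : ℝ≥0∞} (he0 : e ≠ ⊤) (heq : q⁻¹ < e) {γ : ℝ}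
    (hγ : γ < e.toReal - (q⁻¹).toReal) :
    (e - q⁻¹)⁻¹ ≠ 0 ∧ (e - q⁻¹)⁻¹ ≠ ⊤ ∧ γ * ((e - q⁻¹)⁻¹).toReal < 1 ∧
      (((e - q⁻¹)⁻¹)⁻¹).toReal = e.toReal - (q⁻¹).toReal := by
  have h1 : (e - q⁻¹).toReal = e.toReal - (q⁻¹).toReal := ENNReal.toReal_sub_of_le heq.le he0
  have h2 : 0 < e - q⁻¹ := tsub_pos_of_lt heq
  have h3 : e - q⁻¹ ≠ ⊤ := ENNReal.sub_ne_top he0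
  have h4 := ENNReal.toReal_pos h2.ne' h3
  refine ⟨by simpa using h3, by simpa using h2.ne', ?_, by rw [inv_inv, h1]⟩
  rw [ENNReal.toReal_inv, ← div_eq_mul_inv, div_lt_one h4, h1]
  exact hγ

/-- Functions in `L^{r,q}` satisfy Kato bounds. -/
theorem katoBound_of_mixedNorm {d : ℕ} {r q : ℝ≥0∞} (hr2 : 2 ≤ r) (hq : 2 < q)
    (hδ : 0 < delta1 d r q) {σ lam : ℝ} (hσ : 0 < σ) [hl : Fact (0 < lam)] {b : Sp d × ℝ → ℝ}
    (hb : ContDiff ℝ ∞ b) (hc : HasCompactSupport b) {H : ℝ → ℝ}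
    (hHm : AEStronglyMeasurable H volume) (hH0 : ∀ s, 0 ≤ H s)
    (hH : ∀ s, eLpNorm (fun x => b (x, s)) r volume ≤ ENNReal.ofReal (H s)) {h : ℝ} (hh : 0 ≤ h)
    (hHq : eLpNorm H q volume ≤ ENNReal.ofReal h) :
    KatoBound σ lam
      (katoConst d r q * σ ^ (-(dimRatio d r + 1)) * lam ^ (-delta1 d r q) * h) b := by
  have hlam : 0 < lam := hl.out
  have hbc := hb.continuous
  have hbb := exists_bound hbc hc
  have hq1 : q⁻¹ < 2⁻¹ := ENNReal.inv_lt_inv.2 hq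
  have hq2 : q⁻¹ < 1 := hq1.trans (by norm_num)
  obtain ⟨a0, a1, a2, a3⟩ := exponent_conditions (q := q) (e := 2⁻¹)
    (γ := dimRatio d r / 2) (by simp) hq1 (by
      have : (2⁻¹ : ℝ≥0∞).toReal = 1 / 2 := by simp
      rw [this]; unfold delta1 at hδ; linarith)
  obtain ⟨c0, c1, c2, c3⟩ := exponent_conditions (q := q) (e := 1)
    (γ := (1 + dimRatio d r) / 2) (by simp) hq2 (by
      rw [ENNReal.toReal_one]; unfold delta1 at hδ; linarith)
  set A := gammaConst (dimRatio d r / 2) ((2⁻¹ - q⁻¹)⁻¹).toReal with hA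
  set A' := gammaConst ((1 + dimRatio d r) / 2) ((1 - q⁻¹)⁻¹).toReal with hA'
  set K := (gaussConst d r).toReal with hK
  set ρ := dimRatio d r with hρ
  set δ := delta1 d r q with hδ'
  have hA0 : 0 ≤ A := gammaConst_nonneg (ENNReal.toReal_pos a0 a1) a2
  have hA0' : 0 ≤ A' := gammaConst_nonneg (ENNReal.toReal_pos c0 c1) c2
  have hK0 : 0 ≤ K := ENNReal.toReal_nonneg
  have hrms := fun (p : Sp d × ℝ) (τ : ℝ) (hτ : 0 < τ) =>
    rms_le_of_eLpNorm_le hr2 hbc hbb hH0 hH hσ p hτ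
  have hrc := fun p => continuous_rms (σ := σ) hbc hbb p
  have hconst : katoConst d r q = K * (A * (1 / 2) ^ (-δ) + A') := rfl
  rw [hconst]
  have h2δ : (0 : ℝ) < (1 / 2) ^ (-δ) := by positivity
  refine ⟨hb, hc, by positivity, fun p => ?_, fun p => ?_⟩
  · rw [Res_sq_eq hbc hbb]
    have hHol : ENNReal.HolderTriple (2⁻¹ - q⁻¹)⁻¹ q 2 :=
      ⟨by rw [inv_inv, tsub_add_cancel_of_le hq1.le]⟩
    have hw := eLpNorm_weight_mul_le (q := q) (κ := (2⁻¹ - q⁻¹)⁻¹) (e := 2) hHm p.2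
      (γ := ρ / 2) (μ := lam / 2) a0 a1 (by positivity) a2
    have hexp : ρ / 2 - (((2⁻¹ - q⁻¹)⁻¹)⁻¹ : ℝ≥0∞).toReal = -δ := by
      rw [a3, hδ', delta1, ENNReal.toReal_inv]
      simp only [ENNReal.toReal_ofNat]
      ring
    rw [hexp, ← hA] at hw
    refine (setIntegral_le_of_lintegral_le (c := (K * σ ^ (-ρ) * (A * (lam / 2) ^ (-δ) * h)) ^ 2)
      (g := fun τ => (K * σ ^ (-ρ)) ^ 2 *
        (τ ^ (-(ρ / 2)) * Real.exp (-(lam / 2) * τ) * H (p.2 + τ)) ^ 2)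
      (.inl (by have := hrc p; fun_prop)) (fun τ _ => by positivity) (fun τ hτ => ?_)
      (by positivity) ?_).trans ?_
    · have h1 := hrms p τ hτ
      rw [rpow_mul_sqrt hσ hτ] at h1
      -- The exponential is split evenly because the estimate is an `L²` norm in time; hence the
      -- rate `λ/2` and the factor `(1/2)^{-δ₁}` in `katoConst`.
      have h2 : Real.exp (-lam * τ) = Real.exp (-(lam / 2) * τ) ^ 2 := by
        rw [← Real.exp_nat_mul]; congr 1; push_cast; ring
      calc _ ≤ Real.exp (-lam * τ) * (K * (σ ^ (-ρ) * τ ^ (-(ρ / 2))) * H (p.2 + τ)) ^ 2 :=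
            mul_le_mul_of_nonneg_left (pow_le_pow_left₀ (Real.sqrt_nonneg _) h1 2)
              (Real.exp_nonneg _)
        _ = _ := by rw [h2]; ring
    · have h3 : ∀ τ, ENNReal.ofReal ((K * σ ^ (-ρ)) ^ 2 *
          (τ ^ (-(ρ / 2)) * Real.exp (-(lam / 2) * τ) * H (p.2 + τ)) ^ 2)
          = ENNReal.ofReal (K * σ ^ (-ρ)) ^ 2 *
            ‖τ ^ (-(ρ / 2)) * Real.exp (-(lam / 2) * τ) * H (p.2 + τ)‖ₑ ^ 2 := fun τ => by
        rw [ENNReal.ofReal_mul (by positivity), ENNReal.ofReal_pow (by positivity), ← sq_abs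
          (_ * H _), ENNReal.ofReal_pow (abs_nonneg _), Real.enorm_eq_ofReal_abs]
      have h2 := eLpNorm_nnreal_pow_eq_lintegral (μ := volume.restrict (Ioi (0 : ℝ)))
        (f := fun τ : ℝ => τ ^ (-(ρ / 2)) * Real.exp (-(lam / 2) * τ) * H (p.2 + τ)) (p := 2)
        (by norm_num)
      simp only [NNReal.coe_ofNat, ENNReal.rpow_ofNat, ENNReal.coe_ofNat] at h2
      simp_rw [h3]
      rw [lintegral_const_mul' _ _ (by finiteness), ← h2, ← mul_pow,
        ENNReal.ofReal_pow (by positivity),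
        ENNReal.ofReal_mul (p := K * σ ^ (-ρ)) (by positivity),
        ENNReal.ofReal_mul (p := A * (lam / 2) ^ (-δ)) (by positivity)]
      gcongr
      exact hw.trans (by gcongr)
    · refine pow_le_pow_left₀ (by positivity) ?_ 2
      -- The spare `σ` is the one in the bound `(σβ)²`.
      have h4 : σ ^ (-ρ) = σ * σ ^ (-(ρ + 1)) := by
        rw [neg_add, Real.rpow_add hσ, Real.rpow_neg_one]
        field_simp
      have h5 : (lam / 2) ^ (-δ) = lam ^ (-δ) * (1 / 2) ^ (-δ) := by
        rw [← Real.mul_rpow hlam.le (by norm_num)]; congr 1; ring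
      rw [h4, h5]
      -- `katoConst` adds the constants of the two Kato bounds; this is the summand that this bound
      -- does not use.
      have h6 : 0 ≤ K * A' * σ * σ ^ (-(ρ + 1)) * lam ^ (-δ) * h := by positivity
      nlinarith [h6]
  · have hHol : ENNReal.HolderTriple (1 - q⁻¹)⁻¹ q 1 :=
      ⟨by rw [inv_inv, tsub_add_cancel_of_le hq2.le, inv_one]⟩
    have hw := eLpNorm_weight_mul_le (q := q) (κ := (1 - q⁻¹)⁻¹) (e := 1) hHm p.2
      (γ := (1 + ρ) / 2) (μ := lam) c0 c1 hlam c2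
    have hexp : (1 + ρ) / 2 - (((1 - q⁻¹)⁻¹)⁻¹ : ℝ≥0∞).toReal = -δ := by
      rw [c3, hδ', delta1]
      simp only [ENNReal.toReal_one]
      ring
    rw [hexp, ← hA', eLpNorm_one_eq_lintegral_enorm] at hw
    refine (setIntegral_le_of_lintegral_le (c := K * σ ^ (-(ρ + 1)) * (A' * lam ^ (-δ) * h))
      (g := fun τ => (K * σ ^ (-(ρ + 1))) *
        |τ ^ (-((1 + ρ) / 2)) * Real.exp (-lam * τ) * H (p.2 + τ)|)
      (.inr ((show Measurable fun τ : ℝ => Real.exp (-lam * τ) by fun_prop).mul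
        ((show Measurable fun τ : ℝ => (σ * √τ)⁻¹ by fun_prop).mul (hrc p).measurable)))
      (fun τ _ => mul_nonneg (Real.exp_nonneg _) (mul_nonneg (by positivity)
        (Real.sqrt_nonneg _))) (fun τ hτ => ?_)
      (by positivity) ?_).trans ?_
    · have hτ' : (0 : ℝ) < τ := hτ
      have h1 := hrms p τ hτ
      have hpos : 0 < σ * √τ := mul_pos hσ (Real.sqrt_pos.2 hτ')
      have h0 := hH0 (p.2 + τ)
      -- The extra `(σ√τ)⁻¹` from integration by parts raises the time singularity from `ρ/2` to
      -- `(1+ρ)/2`; Hölder now lands in `L¹` instead of `L²`.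
      have h2 : (σ * √τ)⁻¹ * (σ * √τ) ^ (-ρ) = σ ^ (-(ρ + 1)) * τ ^ (-((1 + ρ) / 2)) := by
        rw [← Real.rpow_neg_one, ← Real.rpow_add hpos, show -1 + -ρ = -(ρ + 1) by ring,
          rpow_mul_sqrt hσ hτ', add_comm ρ 1]
      rw [abs_of_nonneg (by positivity)]
      calc _ ≤ Real.exp (-lam * τ) * ((σ * √τ)⁻¹ * (K * (σ * √τ) ^ (-ρ) * H (p.2 + τ))) :=
            mul_le_mul_of_nonneg_left (mul_le_mul_of_nonneg_left h1 (by positivity))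
              (Real.exp_nonneg _)
        _ = Real.exp (-lam * τ) * K * H (p.2 + τ) * ((σ * √τ)⁻¹ * (σ * √τ) ^ (-ρ)) := by ring
        _ = _ := by rw [h2]; ring
    · simp_rw [ENNReal.ofReal_mul (show 0 ≤ K * σ ^ (-(ρ + 1)) by positivity),
        ← Real.enorm_eq_ofReal_abs]
      rw [lintegral_const_mul' _ _ (by finiteness),
        ENNReal.ofReal_mul (p := A' * lam ^ (-δ)) (by positivity)]
      gcongr
      exact hw.trans (by gcongr)
    · have h6 : 0 ≤ K * A * (1 / 2) ^ (-δ) * σ ^ (-(ρ + 1)) * lam ^ (-δ) * h := by positivity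
      nlinarith [h6]

end DavieBound

/-! ### Brownian motion: a measurable continuous version and the weak Markov property. -/

namespace DavieBound

open Filter Topology

/-- Independence of pairs, and independence within each pair, gives independence of the two
families of components. -/
lemma indepFun_of_iIndepFun_prodMk {Ω ι α β : Type*} [MeasurableSpace Ω] [MeasurableSpace α]
    [MeasurableSpace β] [Fintype ι] {P : Measure Ω} [IsProbabilityMeasure P] {X : ι → Ω → α}
    {Y : ι → Ω → β} (hX : ∀ i, Measurable (X i)) (hY : ∀ i, Measurable (Y i))
    (h : iIndepFun (fun i ω => (X i ω, Y i ω)) P) (hi : ∀ i, IndepFun (X i) (Y i) P) :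
    IndepFun (fun ω i => X i ω) (fun ω i => Y i ω) P ∧
      P.map (fun ω i => Y i ω) = Measure.pi fun i => P.map (Y i) := by
  have hpX : ∀ i, IsProbabilityMeasure (P.map (X i)) := fun i =>
    Measure.isProbabilityMeasure_map (hX i).aemeasurable
  have hpY : ∀ i, IsProbabilityMeasure (P.map (Y i)) := fun i =>
    Measure.isProbabilityMeasure_map (hY i).aemeasurable
  have hjoint := h.map_fun_eq_pi_map fun i => ((hX i).prodMk (hY i)).aemeasurable
  have hpair : ∀ i, P.map (fun ω => (X i ω, Y i ω)) = (P.map (X i)).prod (P.map (Y i)) := fun i =>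
    (hi i).map_prod_eq_prod_map_map (hX i).aemeasurable (hY i).aemeasurable
  simp_rw [hpair] at hjoint
  -- The joint law is a product of products; regrouping its factors exhibits it as the law of the
  -- `X` family times that of the `Y` family.
  have hmp := (measurePreserving_arrowProdEquivProdArrow α β ι (fun i => P.map (X i))
    (fun i => P.map (Y i))).map_eq
  rw [← hjoint, Measure.map_map (MeasurableEquiv.measurable _)
    (measurable_pi_lambda _ fun i => (hX i).prodMk (hY i))] at hmp
  have hX' : iIndepFun X P := h.comp (fun _ => Prod.fst) fun _ => measurable_fst
  have hY' : iIndepFun Y P := h.comp (fun _ => Prod.snd) fun _ => measurable_snd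
  have eX := hX'.map_fun_eq_pi_map fun i => (hX i).aemeasurable
  have eY := hY'.map_fun_eq_pi_map fun i => (hY i).aemeasurable
  refine ⟨?_, eY⟩
  rw [indepFun_iff_map_prod_eq_prod_map_map (measurable_pi_lambda _ hX).aemeasurable
    (measurable_pi_lambda _ hY).aemeasurable, eX, eY]
  exact hmp

section

variable {d : ℕ} {Ω : Type*} [MeasurableSpace Ω] {P : Measure Ω} {B : ℝ≥0 → Ω → Sp d}

/-- A Brownian motion agrees almost surely with a measurable process with continuous paths. -/
lemma IsStandardBrownian.exists_good_version (hB : IsStandardBrownian B P) :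
    ∃ B' : ℝ≥0 → Ω → Sp d, (∀ t, Measurable (B' t)) ∧ (∀ ω, Continuous (fun t => B' t ω)) ∧
      (∀ᵐ ω ∂P, ∀ t, B t ω = B' t ω) := by
  have hm : ∀ t, AEMeasurable (B t) P := fun t => by
    have : AEMeasurable (fun ω k => B t ω k) P :=
      aemeasurable_pi_lambda _ fun k => (hB.coord k).aemeasurable t
    exact (WithLp.measurable_toLp 2 (Fin d → ℝ)).comp_aemeasurable this
  have hc : ∀ᵐ ω ∂P, Continuous fun t => B t ω := by
    filter_upwards [ae_all_iff.2 fun k => (hB.coord k).cont] with ω hω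
    exact (PiLp.continuous_toLp 2 _).comp (continuous_pi hω)
  -- Measurable modifications need only be compared at countably many times, outside one null set;
  -- path continuity supplies the other times as limits.
  obtain ⟨D, hDc, hDd⟩ := TopologicalSpace.exists_countable_dense ℝ≥0
  have hae : ∀ᵐ ω ∂P, (Continuous fun t => B t ω) ∧ ∀ t ∈ D, B t ω = (hm t).mk _ ω :=
    hc.and ((ae_ball_iff hDc).2 fun t _ => (hm t).ae_eq_mk)
  obtain ⟨N, hN, hNm, hNP⟩ := exists_measurable_superset_of_null hae
  have hgood : ∀ ω ∉ N, (Continuous fun t => B t ω) ∧ ∀ t ∈ D, B t ω = (hm t).mk _ ω :=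
    fun ω hω => not_not.1 fun h => hω (hN h)
  classical
  have hcont : ∀ ω, Continuous fun t => if ω ∈ N then 0 else B t ω := fun ω => by
    by_cases hω : ω ∈ N
    · simpa [hω] using continuous_const
    · simpa [hω] using (hgood ω hω).1
  have hDm : ∀ t ∈ D, Measurable fun ω => if ω ∈ N then 0 else B t ω := fun t ht => by
    have : (fun ω => if ω ∈ N then 0 else B t ω) = fun ω => if ω ∈ N then 0 else (hm t).mk _ ω := by
      ext1 ω
      by_cases hω : ω ∈ N
      · simp [hω]
      · simp [hω, (hgood ω hω).2 t ht]
    rw [this]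
    exact Measurable.ite hNm measurable_const (hm t).measurable_mk
  refine ⟨fun t ω => if ω ∈ N then 0 else B t ω, fun t => ?_, hcont, ?_⟩
  · obtain ⟨u, hu, hut⟩ := mem_closure_iff_seq_limit.1 (hDd t)
    exact measurable_of_tendsto_metrizable (fun n => hDm (u n) (hu n))
      (tendsto_pi_nhds.2 fun ω => ((hcont ω).tendsto t).comp hut)
  · have : ∀ᵐ ω ∂P, ω ∉ N := measure_eq_zero_iff_ae_notMem.1 hNP
    filter_upwards [this] with ω hω t
    simp [hω]

lemma IsStandardBrownian.congr {B' : ℝ≥0 → Ω → Sp d} (hB : IsStandardBrownian B P)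
    (hc : ∀ ω, Continuous (fun t => B' t ω)) (h : ∀ᵐ ω ∂P, ∀ t, B t ω = B' t ω) :
    IsStandardBrownian B' P where
  coord k :=
    { toIsPreBrownianReal := (hB.coord k).toIsPreBrownianReal.congr fun t => by
        filter_upwards [h] with ω hω
        rw [hω]
      cont := .of_forall fun ω => by
        have := hc ω
        fun_prop }
  indep := hB.indep.congr fun k => by
    filter_upwards [h] with ω hω
    ext t
    rw [hω]

variable [IsProbabilityMeasure P]

/-- The weak Markov property: increments are independent of the past, with Gaussian law. -/
lemma IsStandardBrownian.indepFun_increment (hB : IsStandardBrownian B P)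
    (hm : ∀ t, Measurable (B t)) {s t : ℝ≥0} (hst : s ≤ t) :
    IndepFun (fun ω (u : Iic s) => B u ω) (fun ω => B t ω - B s ω) P ∧
      P.map (fun ω => B t ω - B s ω)
        = (stdGaussian (Sp d)).map fun z => √((t : ℝ) - s) • z := by
  have hm' : ∀ k t, Measurable fun ω => B t ω k := fun k t => by have := hm t; fun_prop
  -- In each coordinate the past and the increment are independent by the one-dimensional Markov
  -- property, and the coordinates are independent of each other.
  obtain ⟨h1, h2⟩ := indepFun_of_iIndepFun_prodMk (P := P)
    (X := fun k ω (u : Iic s) => B u ω k) (Y := fun k ω => B t ω k - B s ω k)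
    (fun k => measurable_pi_lambda _ fun u => hm' k u) (fun k => (hm' k t).sub (hm' k s))
    (hB.indep.comp (fun _ f => (fun u : Iic s => f u, f t - f s)) fun _ => by fun_prop)
    (fun k => by
      have := ((hB.coord k).indepFun_shift s).symm.comp (φ := id)
        (ψ := fun f : ℝ≥0 → ℝ => f (t - s)) measurable_id
        (show Measurable fun f : ℝ≥0 → ℝ => f (t - s) from measurable_pi_apply (t - s))
      simpa [Function.comp_def, add_tsub_cancel_of_le hst] using this)
  constructor
  · have := h1.comp (φ := fun f (u : Iic s) => WithLp.toLp 2 fun k => f k u)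
      (ψ := fun f : Fin d → ℝ => WithLp.toLp 2 f) (by fun_prop) (by fun_prop)
    exact this
  · have hlaw : ∀ k, P.map (fun ω => B t ω k - B s ω k)
        = (gaussianReal 0 1).map (fun x => √((t : ℝ) - s) * x) := fun k => by
      have := ((hB.coord k).hasLaw_sub t s).map_eq
      rw [gaussianReal_map_const_mul, mul_zero]
      refine Eq.trans this (congrArg (gaussianReal 0) (NNReal.eq ?_))
      have hst' : (s : ℝ) ≤ t := hst
      simp [Real.sq_sqrt (sub_nonneg.2 hst'), Real.dist_eq, abs_of_nonneg (sub_nonneg.2 hst')]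
    simp_rw [hlaw] at h2
    rw [← map_pi_eq_stdGaussian, Measure.map_map (by fun_prop) (by fun_prop)]
    have h3 : (fun ω => B t ω - B s ω)
        = (WithLp.toLp 2) ∘ fun ω k => B t ω k - B s ω k := by
      ext ω k; simp
    have h4 : Measurable fun ω (k : Fin d) => B t ω k - B s ω k :=
      measurable_pi_lambda _ fun k => (hm' k t).sub (hm' k s)
    rw [h3, ← Measure.map_map (by fun_prop) h4, h2,
      ← Measure.pi_map_pi (fun _ => by fun_prop), Measure.map_map (by fun_prop) (by fun_prop)]
    rfl

/-- Averaging over the increment of Brownian motion after time `s`. -/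
lemma IsStandardBrownian.integral_increment (hB : IsStandardBrownian B P)
    (hm : ∀ t, Measurable (B t)) {s t : ℝ≥0} (hst : s ≤ t)
    {F : (Iic s → Sp d) × Sp d → ℝ} (hF : Measurable F) {C : ℝ} (hC : ∀ x, |F x| ≤ C) :
    ∫ ω, F (fun u => B u ω, B t ω - B s ω) ∂P
      = ∫ ω, ∫ z, F (fun u => B u ω, √((t : ℝ) - s) • z) ∂(stdGaussian (Sp d)) ∂P := by
  obtain ⟨h1, h2⟩ := hB.indepFun_increment hm hst
  have hm1 : Measurable fun ω (u : Iic s) => B u ω := measurable_pi_lambda _ fun u => hm u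
  have hm2 : Measurable fun ω => B t ω - B s ω := (hm t).sub (hm s)
  have : IsProbabilityMeasure (P.map fun ω (u : Iic s) => B u ω) :=
    Measure.isProbabilityMeasure_map hm1.aemeasurable
  have hms : Measurable fun z : Sp d => √((t : ℝ) - s) • z := by fun_prop
  have : IsProbabilityMeasure ((stdGaussian (Sp d)).map fun z => √((t : ℝ) - s) • z) :=
    Measure.isProbabilityMeasure_map hms.aemeasurable
  have h3 := h1.map_prod_eq_prod_map_map hm1.aemeasurable hm2.aemeasurable
  rw [h2] at h3
  rw [← integral_map (φ := fun ω => ((fun u : Iic s => B u ω), B t ω - B s ω))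
    (hm1.prodMk hm2).aemeasurable hF.aestronglyMeasurable, h3, integral_prod _
      (Integrable.of_bound hF.aestronglyMeasurable C (.of_forall hC)), integral_map
      hm1.aemeasurable]
  · congr 1 with ω
    rw [integral_map hms.aemeasurable]
    exact (hF.comp (measurable_const.prodMk measurable_id)).aestronglyMeasurable
  · exact (hF.stronglyMeasurable.integral_prod_right').aestronglyMeasurable

end

end DavieBound

/-! ### Peeling off the last time of the simplex. -/

namespace DavieBound

open Filter Topology

/-- The last entry of a finite sequence of times preceded by `0`. -/
def lastTime {n : ℕ} (s : Fin n → ℝ) : ℝ := (Fin.cons 0 s : Fin (n + 1) → ℝ) (Fin.last n)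

lemma lastTime_succ {n : ℕ} (s : Fin (n + 1) → ℝ) : lastTime s = s (Fin.last n) := rfl

lemma lastTime_snoc {n : ℕ} (s : Fin n → ℝ) (u : ℝ) :
    lastTime (Fin.snoc s u : Fin (n + 1) → ℝ) = u := by
  rw [lastTime_succ, Fin.snoc_last]

lemma continuous_lastTime {n : ℕ} : Continuous (lastTime (n := n)) := by
  cases n with
  | zero => exact continuous_const
  | succ n => exact continuous_apply _

lemma le_lastTime {n : ℕ} {t : ℝ} {s : Fin n → ℝ} (hs : s ∈ orderedSimplex n t) (i : Fin n) :
    s i ≤ lastTime s := by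
  cases n with
  | zero => exact i.elim0
  | succ n => exact hs.1 (Fin.le_last i)

lemma lastTime_mem {n : ℕ} {t : ℝ} (ht : 0 ≤ t) {s : Fin n → ℝ} (hs : s ∈ orderedSimplex n t) :
    lastTime s ∈ Icc 0 t := by
  cases n with
  | zero => exact ⟨le_rfl, ht⟩
  | succ n => exact hs.2 _

lemma snoc_mem_orderedSimplex {n : ℕ} {t : ℝ} (ht : 0 ≤ t) (s : Fin n → ℝ) (u : ℝ) :
    (Fin.snoc s u : Fin (n + 1) → ℝ) ∈ orderedSimplex (n + 1) t
      ↔ s ∈ orderedSimplex n t ∧ u ∈ Icc (lastTime s) t := by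
  constructor
  · rintro ⟨hm, hI⟩
    have hs : s ∈ orderedSimplex n t := by
      refine ⟨fun i j hij => ?_, fun i => ?_⟩
      · simpa using hm (Fin.castSucc_le_castSucc_iff.2 hij)
      · simpa using hI i.castSucc
    have hu : u ∈ Icc 0 t := by simpa using hI (Fin.last n)
    refine ⟨hs, ?_, hu.2⟩
    cases n with
    | zero => exact hu.1
    | succ n =>
      have := hm (Fin.le_last (Fin.last n).castSucc)
      rwa [Fin.snoc_castSucc (α := fun _ => ℝ), Fin.snoc_last] at this
  · rintro ⟨hs, hu⟩
    have h0 := (lastTime_mem ht hs).1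
    refine ⟨fun i j hij => ?_, fun i => ?_⟩
    · induction j using Fin.lastCases with
      | last =>
        induction i using Fin.lastCases with
        | last => exact le_rfl
        | cast i => simpa using (le_lastTime hs i).trans hu.1
      | cast j =>
        induction i using Fin.lastCases with
        | last => exact absurd hij (not_le.2 (Fin.castSucc_lt_last j))
        | cast i => simpa using hs.1 (Fin.castSucc_le_castSucc_iff.1 hij)
    · induction i using Fin.lastCases with
      | last => simpa using ⟨h0.trans hu.1, hu.2⟩
      | cast i => simpa using hs.2 i

lemma measurableSet_orderedSimplex (n : ℕ) (t : ℝ) : MeasurableSet (orderedSimplex n t) := by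
  have : orderedSimplex n t = (⋂ i, ⋂ j, ⋂ _ : i ≤ j, {s : Fin n → ℝ | s i ≤ s j})
      ∩ ⋂ i, {s | s i ∈ Icc 0 t} := by
    ext s
    simp [orderedSimplex, Monotone]
  rw [this]
  refine MeasurableSet.inter ?_ (MeasurableSet.iInter fun i => ?_)
  · exact MeasurableSet.iInter fun i => MeasurableSet.iInter fun j => MeasurableSet.iInter fun _ =>
      measurableSet_le (measurable_pi_apply i) (measurable_pi_apply j)
  · exact (measurable_pi_apply i) measurableSet_Icc

lemma volume_orderedSimplex_lt_top (n : ℕ) (t : ℝ) : volume (orderedSimplex n t) < ⊤ := by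
  refine (measure_mono (t := Icc (fun _ => (0 : ℝ)) (fun _ => t)) fun s hs => ?_).trans_lt
    isCompact_Icc.measure_lt_top
  exact ⟨fun i => (hs.2 i).1, fun i => (hs.2 i).2⟩

instance isFiniteMeasure_restrict_orderedSimplex (n : ℕ) (t : ℝ) :
    IsFiniteMeasure (volume.restrict (orderedSimplex n t)) :=
  ⟨by simpa using volume_orderedSimplex_lt_top n t⟩

section

variable {d : ℕ} {Ω : Type*} {B : ℝ≥0 → Ω → Sp d} {a : Sp d} {σ : ℝ}

/-- The space-time position of the scaled Brownian motion started from `a`. -/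
def pos (B : ℝ≥0 → Ω → Sp d) (a : Sp d) (σ : ℝ) (u : ℝ) (x : Ω) : Sp d × ℝ :=
  (a + σ • B u.toNNReal x, u)

/-- The integrand of the iterated expansion. -/
noncomputable def pathProd {n : ℕ} (B : ℝ≥0 → Ω → Sp d) (a : Sp d) (σ lam : ℝ)
    (g : Fin n → Sp d × ℝ → ℝ) (h : Sp d × ℝ → ℝ) (s : Fin n → ℝ) (x : Ω) : ℝ :=
  (∏ i, g i (pos B a σ (s i) x)) * (Real.exp (-lam * lastTime s) * h (pos B a σ (lastTime s) x))

lemma exists_bound_pathProd {n : ℕ} {t lam : ℝ} (hlam : 0 ≤ lam) (ht : 0 ≤ t)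
    {g : Fin n → Sp d × ℝ → ℝ} {h : Sp d × ℝ → ℝ} (hg : ∀ i, ∃ C, ∀ p, |g i p| ≤ C)
    (hh : ∃ C, ∀ p, |h p| ≤ C) :
    ∃ C, ∀ s ∈ orderedSimplex n t, ∀ x, |pathProd B a σ lam g h s x| ≤ C := by
  choose C hC using hg
  obtain ⟨D, hD⟩ := hh
  refine ⟨(∏ i, C i) * D, fun s hs x => ?_⟩
  rw [pathProd, abs_mul, abs_mul, Finset.abs_prod, Real.abs_exp]
  have h0 : ∀ i, 0 ≤ C i := fun i => (abs_nonneg _).trans (hC i 0)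
  refine mul_le_mul (Finset.prod_le_prod (fun i _ => abs_nonneg _) fun i _ => hC i _) ?_
    (by positivity) (Finset.prod_nonneg fun i _ => h0 i)
  have h1 : Real.exp (-lam * lastTime s) ≤ 1 := by
    rw [Real.exp_le_one_iff]
    nlinarith [(lastTime_mem ht hs).1]
  exact (mul_le_of_le_one_left (abs_nonneg _) h1).trans (hD _)

variable [MeasurableSpace Ω]

lemma measurable_pos (hm : ∀ t, Measurable (B t)) (hc : ∀ x, Continuous fun t => B t x) :
    Measurable fun p : ℝ × Ω => pos B a σ p.1 p.2 := by
  have h1 : Measurable (Function.uncurry B) := measurable_uncurry_of_continuous_of_measurable hc hm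
  have h2 : Measurable fun p : ℝ × Ω => B p.1.toNNReal p.2 :=
    h1.comp (f := fun p : ℝ × Ω => (p.1.toNNReal, p.2)) (by fun_prop)
  unfold pos
  fun_prop

lemma measurable_pathProd (hm : ∀ t, Measurable (B t)) (hc : ∀ x, Continuous fun t => B t x)
    {n : ℕ} {lam : ℝ} {g : Fin n → Sp d × ℝ → ℝ} {h : Sp d × ℝ → ℝ} (hg : ∀ i, Continuous (g i))
    (hh : Continuous h) :
    Measurable fun p : (Fin n → ℝ) × Ω => pathProd B a σ lam g h p.1 p.2 := by
  have hp := measurable_pos (a := a) (σ := σ) hm hc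
  have hl : Measurable fun p : (Fin n → ℝ) × Ω => lastTime p.1 :=
    continuous_lastTime.measurable.comp measurable_fst
  have h1 : ∀ i, Measurable fun p : (Fin n → ℝ) × Ω => g i (pos B a σ (p.1 i) p.2) := fun i =>
    (hg i).measurable.comp (hp.comp (f := fun p : (Fin n → ℝ) × Ω => (p.1 i, p.2)) (by fun_prop))
  have h2 : Measurable fun p : (Fin n → ℝ) × Ω => h (pos B a σ (lastTime p.1) p.2) :=
    hh.measurable.comp (hp.comp (f := fun p : (Fin n → ℝ) × Ω => (lastTime p.1, p.2)) (by fun_prop))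
  unfold pathProd
  fun_prop

variable {P : Measure Ω} [IsProbabilityMeasure P]

lemma integrable_pathProd (hm : ∀ t, Measurable (B t)) (hc : ∀ x, Continuous fun t => B t x)
    {n : ℕ} {t lam : ℝ} (hlam : 0 ≤ lam) (ht : 0 ≤ t) {g : Fin n → Sp d × ℝ → ℝ}
    {h : Sp d × ℝ → ℝ} (hg : ∀ i, Continuous (g i)) (hh : Continuous h)
    (hgb : ∀ i, ∃ C, ∀ p, |g i p| ≤ C) (hhb : ∃ C, ∀ p, |h p| ≤ C) :
    Integrable (fun p : (Fin n → ℝ) × Ω => pathProd B a σ lam g h p.1 p.2)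
      ((volume.restrict (orderedSimplex n t)).prod P) := by
  obtain ⟨C, hC⟩ := exists_bound_pathProd (B := B) (a := a) (σ := σ) hlam ht hgb hhb
  refine Integrable.of_bound (measurable_pathProd hm hc hg hh).aestronglyMeasurable C ?_
  have := Measure.quasiMeasurePreserving_fst (μ := volume.restrict (orderedSimplex n t)) (ν := P)
  filter_upwards [this.ae (ae_restrict_mem (measurableSet_orderedSimplex n t))] with p hp
  exact hC p.1 hp p.2

/-- The Markov property at time `l`, integrated against the killed time. -/
lemma IsStandardBrownian.integral_mul_Res (hB : IsStandardBrownian B P)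
    (hm : ∀ t, Measurable (B t)) {lam l : ℝ} [Fact (0 < lam)] (hl : 0 ≤ l)
    {Φ : (Iic l.toNNReal → Sp d) → ℝ} (hΦ : Measurable Φ) {C : ℝ} (hC : ∀ y, |Φ y| ≤ C)
    {G : Sp d × ℝ → ℝ} (hG : Continuous G) {D : ℝ} (hD : ∀ p, |G p| ≤ D) :
    ∫ x, Φ (fun u => B u x) * Res σ lam G (pos B a σ l x) ∂P
      = ∫ τ in Ioi 0, Real.exp (-lam * τ) *
        ∫ x, Φ (fun u => B u x) * G (pos B a σ (l + τ) x) ∂P := by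
  have hpast : Measurable fun x (u : Iic l.toNNReal) => B u x :=
    measurable_pi_lambda _ fun u => hm u
  have hpl : Measurable (pos B a σ l) := by
    have := hm l.toNNReal
    unfold pos
    fun_prop
  have hs := (continuous_shift (d := d) σ).measurable
  have hCD : ∀ y p, |Φ y * G p| ≤ C * D := fun y p => by
    rw [abs_mul]
    exact mul_le_mul (hC y) (hD p) (abs_nonneg _) ((abs_nonneg _).trans (hC y))
  have hmeas : Measurable fun p : Ω × (ℝ × Sp d) =>
      Φ (fun u => B u p.1) * G (pos B a σ l p.1 + shift σ p.2) := by
    have h1 : Measurable fun p : Ω × (ℝ × Sp d) => Φ (fun u => B u p.1) :=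
      hΦ.comp (hpast.comp measurable_fst)
    have h2 : Measurable fun p : Ω × (ℝ × Sp d) => G (pos B a σ l p.1 + shift σ p.2) :=
      hG.measurable.comp (by fun_prop)
    exact h1.mul h2
  have hint : Integrable (fun p : Ω × (ℝ × Sp d) =>
      Φ (fun u => B u p.1) * G (pos B a σ l p.1 + shift σ p.2)) (P.prod (killedLaw d lam)) :=
    Integrable.of_bound hmeas.aestronglyMeasurable (C * D) (.of_forall fun p => hCD _ _)
  have hintτ : ∀ τ : ℝ, Integrable (fun p : Ω × Sp d =>
      Φ (fun u => B u p.1) * G (pos B a σ l p.1 + shift σ (τ, p.2)))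
      (P.prod (stdGaussian (Sp d))) := fun τ =>
    Integrable.of_bound (hmeas.comp (g := fun p : Ω × (ℝ × Sp d) =>
      Φ (fun u => B u p.1) * G (pos B a σ l p.1 + shift σ p.2))
      (f := fun p : Ω × Sp d => (p.1, (τ, p.2))) (by fun_prop)).aestronglyMeasurable (C * D)
      (.of_forall fun p => hCD _ _)
  -- The position at `l + τ` is the position at `l` plus an increment independent of the past, with
  -- the law of `σ√τ z`.
  have hmk : ∀ τ ∈ Ioi (0 : ℝ), ∫ x, Φ (fun u => B u x) * G (pos B a σ (l + τ) x) ∂P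
      = ∫ x, ∫ z, Φ (fun u => B u x) * G (pos B a σ l x + shift σ (τ, z))
        ∂(stdGaussian (Sp d)) ∂P := by
    intro τ hτ
    have hτ' : (0 : ℝ) < τ := hτ
    have hle : l.toNNReal ≤ (l + τ).toNNReal := Real.toNNReal_le_toNNReal (by linarith)
    have hF : Measurable fun y : (Iic l.toNNReal → Sp d) × Sp d =>
        Φ y.1 * G (a + σ • (y.1 ⟨l.toNNReal, mem_Iic.2 le_rfl⟩ + y.2), l + τ) := by
      have h1 : Measurable fun y : (Iic l.toNNReal → Sp d) × Sp d =>
          y.1 ⟨l.toNNReal, mem_Iic.2 le_rfl⟩ := (measurable_pi_apply _).comp measurable_fst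
      exact (hΦ.comp measurable_fst).mul (hG.measurable.comp (by fun_prop))
    have key := hB.integral_increment hm hle hF (fun y => hCD _ _)
    have e1 : √(((l + τ).toNNReal : ℝ) - l.toNNReal) = √τ := by
      rw [Real.coe_toNNReal _ hl, Real.coe_toNNReal _ (by linarith)]
      congr 1
      ring
    rw [e1] at key
    have e2 : ∀ (x : Ω) (z : Sp d), pos B a σ l x + shift σ (τ, z)
        = (a + σ • (B l.toNNReal x + √τ • z), l + τ) := fun x z => by
      simp only [pos, shift, Prod.mk_add_mk]
      rw [smul_add, smul_smul, add_assoc]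
    simp_rw [e2]
    rw [← key]
    simp [pos]
  calc ∫ x, Φ (fun u => B u x) * Res σ lam G (pos B a σ l x) ∂P
      = ∫ x, ∫ w, Φ (fun u => B u x) * G (pos B a σ l x + shift σ w) ∂(killedLaw d lam) ∂P := by
        simp_rw [Res, integral_const_mul]
    _ = ∫ w, ∫ x, Φ (fun u => B u x) * G (pos B a σ l x + shift σ w) ∂P ∂(killedLaw d lam) :=
        integral_integral_swap hint
    _ = ∫ τ, ∫ z, ∫ x, Φ (fun u => B u x) * G (pos B a σ l x + shift σ (τ, z)) ∂P
          ∂(stdGaussian (Sp d)) ∂(timeLaw lam) := by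
        rw [killedLaw, integral_prod]
        exact hint.integral_prod_right
    _ = ∫ τ, ∫ x, ∫ z, Φ (fun u => B u x) * G (pos B a σ l x + shift σ (τ, z))
          ∂(stdGaussian (Sp d)) ∂P ∂(timeLaw lam) := by
        congr 1 with τ
        exact (integral_integral_swap (hintτ τ)).symm
    _ = _ := by
        rw [integral_timeLaw]
        refine setIntegral_congr_fun measurableSet_Ioi fun τ hτ => ?_
        simp only
        rw [hmk τ hτ]

/-- The resolvent integrates over a half-line, the simplex over `[l, t]`. Vanishing after `t`
reconciles them, which is why the test functions are cut off there. -/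
lemma setIntegral_Icc_eq_setIntegral_Ioi {l t : ℝ} {f : ℝ → ℝ} (hf : ∀ u, t < u → f u = 0) :
    ∫ u in Icc l t, f u = ∫ τ in Ioi 0, f (l + τ) := by
  have h1 : ∫ u in Icc l t, f u = ∫ u in Ioi l, f u := by
    rw [integral_Icc_eq_integral_Ioc]
    refine (setIntegral_eq_of_subset_of_forall_sdiff_eq_zero measurableSet_Ioi
      Ioc_subset_Ioi_self fun u hu => hf u ?_).symm
    by_contra h
    exact hu.2 ⟨hu.1, not_lt.1 h⟩
  rw [h1, ← integral_indicator measurableSet_Ioi, ← integral_indicator measurableSet_Ioi,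
    ← integral_add_left_eq_self _ l]
  congr 1 with τ
  simp [indicator]

/-- Integrating out the last time of the simplex. -/
lemma IsStandardBrownian.integral_pathProd_snoc (hB : IsStandardBrownian B P)
    (hm : ∀ t, Measurable (B t)) (hc : ∀ x, Continuous fun t => B t x)
    {n : ℕ} {t lam : ℝ} [hl : Fact (0 < lam)] (ht : 0 ≤ t) {g : Fin (n + 1) → Sp d × ℝ → ℝ}
    {h : Sp d × ℝ → ℝ} (hg : ∀ i, Continuous (g i)) (hh : Continuous h)
    (hgb : ∀ i, ∃ C, ∀ p, |g i p| ≤ C) (hhb : ∃ C, ∀ p, |h p| ≤ C)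
    (hgt : ∀ x u, t < u → g (Fin.last n) (x, u) = 0) :
    ∫ s in orderedSimplex (n + 1) t, ∫ x, pathProd B a σ lam g h s x ∂P
      = ∫ s in orderedSimplex n t, ∫ x, pathProd B a σ lam (fun i => g i.castSucc)
          (Res σ lam fun p => g (Fin.last n) p * h p) s x ∂P := by
  have hlam : 0 < lam := hl.out
  set Q : (Fin (n + 1) → ℝ) → ℝ := (orderedSimplex (n + 1) t).indicator
    fun s => ∫ x, pathProd B a σ lam g h s x ∂P with hQ
  have hQint : Integrable Q := by
    rw [hQ, integrable_indicator_iff (measurableSet_orderedSimplex _ _)]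
    exact (integrable_pathProd hm hc hlam.le ht hg hh hgb hhb).integral_prod_left
  have hmp := (volume_preserving_piFinSuccAbove (fun _ : Fin (n + 1) => ℝ) (Fin.last n)).symm
  have hQint' := (hmp.integrable_comp_emb (MeasurableEquiv.measurableEmbedding _)).2 hQint
  rw [← integral_indicator (measurableSet_orderedSimplex _ _), ← hQ,
    ← hmp.integral_comp (MeasurableEquiv.measurableEmbedding _), Measure.volume_eq_prod,
    integral_prod_symm (fun z => Q ((MeasurableEquiv.piFinSuccAbove
      (fun _ : Fin (n + 1) => ℝ) (Fin.last n)).symm z)) hQint',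
    ← integral_indicator (measurableSet_orderedSimplex n t)]
  congr 1 with s
  have hsnoc : ∀ u : ℝ, (MeasurableEquiv.piFinSuccAbove (fun _ : Fin (n + 1) => ℝ)
      (Fin.last n)).symm (u, s) = Fin.snoc s u := fun u => by
    simp [MeasurableEquiv.piFinSuccAbove, Fin.insertNthEquiv, Fin.insertNth_last']
  simp_rw [hsnoc]
  by_cases hs : s ∈ orderedSimplex n t
  · rw [indicator_of_mem hs]
    have hl0 := lastTime_mem ht hs
    set l := lastTime s with hldef
    -- Over a point `s` of the smaller simplex, the last time ranges over `[l, t]`.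
    have hQs : ∀ u, Q (Fin.snoc s u) = (Icc l t).indicator (fun u => Real.exp (-lam * u) *
        ∫ x, (∏ i : Fin n, g i.castSucc (pos B a σ (s i) x)) *
          (g (Fin.last n) (pos B a σ u x) * h (pos B a σ u x)) ∂P) u := fun u => by
      rw [hQ]
      by_cases hu : u ∈ Icc l t
      · rw [indicator_of_mem ((snoc_mem_orderedSimplex ht s u).2 ⟨hs, hu⟩), indicator_of_mem hu,
          ← integral_const_mul]
        congr 1 with x
        simp only [pathProd, Fin.prod_univ_castSucc, Fin.snoc_last, lastTime_snoc,
          Fin.snoc_castSucc (α := fun _ => ℝ)]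
        ring
      · rw [indicator_of_notMem (fun hmem => hu ((snoc_mem_orderedSimplex ht s u).1 hmem).2),
          indicator_of_notMem hu]
    simp_rw [hQs]
    rw [integral_indicator measurableSet_Icc, setIntegral_Icc_eq_setIntegral_Ioi (fun u hu => by
      simp [pos, hgt _ _ hu])]
    choose C hC using hgb
    obtain ⟨D, hD⟩ := hhb
    -- The earlier factors depend only on the path up to `l`, so they can play the role of `Φ`.
    have hle : ∀ i : Fin n, (s i).toNNReal ∈ Iic l.toNNReal := fun i =>
      Real.toNNReal_le_toNNReal (le_lastTime hs i)
    have key := hB.integral_mul_Res (a := a) (σ := σ) (lam := lam) hm hl0.1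
      (Φ := fun y => ∏ i : Fin n, g i.castSucc (a + σ • y ⟨(s i).toNNReal, hle i⟩, s i))
      (C := ∏ i : Fin n, C i.castSucc)
      (Finset.measurable_fun_prod _ fun i _ => (hg i.castSucc).measurable.comp (by
        have : Measurable fun y : Iic l.toNNReal → Sp d => y ⟨(s i).toNNReal, hle i⟩ :=
          measurable_pi_apply _
        fun_prop))
      (fun y => by
        rw [Finset.abs_prod]
        exact Finset.prod_le_prod (fun i _ => abs_nonneg _) fun i _ => hC _ _)
      (G := fun p => g (Fin.last n) p * h p) ((hg _).mul hh) (D := C (Fin.last n) * D)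
      (fun p => by
        rw [abs_mul]
        exact mul_le_mul (hC _ p) (hD p) (abs_nonneg _) ((abs_nonneg _).trans (hC _ p)))
    have e1 : ∀ x, pathProd B a σ lam (fun i : Fin n => g i.castSucc)
        (Res σ lam fun p => g (Fin.last n) p * h p) s x = Real.exp (-lam * l) *
          ((∏ i : Fin n, g i.castSucc (pos B a σ (s i) x)) *
            Res σ lam (fun p => g (Fin.last n) p * h p) (pos B a σ l x)) := fun x => by
      rw [pathProd, ← hldef]; ring
    simp_rw [e1]
    rw [integral_const_mul]
    unfold pos at key ⊢
    rw [key, ← integral_const_mul]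
    congr 1 with τ
    -- The weight at `l` and the killing over `τ` combine to the weight at `l + τ`.
    rw [← mul_assoc, ← Real.exp_add]
    congr 2
    ring
  · rw [indicator_of_notMem hs]
    have : ∀ u, Q (Fin.snoc s u) = 0 := fun u =>
      indicator_of_notMem (fun hmem => hs ((snoc_mem_orderedSimplex ht s u).1 hmem).1) _
    simp [this]

end

end DavieBound

/-! ### The terminal function and the induction on the number of factors. -/

namespace DavieBound

open Filter Topology
open scoped ContDiff

lemma dd_comp_snd {d : ℕ} {η : ℝ → ℝ} (hη : ContDiff ℝ ∞ η) (v : Sp d × ℝ) :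
    dd v (fun p : Sp d × ℝ => η p.2) = fun p => v.2 * deriv η p.2 := by
  funext p
  have h : HasFDerivAt (fun p : Sp d × ℝ => η p.2)
      ((ContinuousLinearMap.toSpanSingleton ℝ (deriv η p.2)).comp
        (ContinuousLinearMap.snd ℝ (Sp d) ℝ)) p :=
    ((hη.differentiable (by simp)).differentiableAt.hasDerivAt.hasFDerivAt).comp p hasFDerivAt_snd
  rw [dd, h.fderiv]
  simp

lemma SmoothBdd.comp_snd {d : ℕ} {η : ℝ → ℝ} (hη : ContDiff ℝ ∞ η) (hc : HasCompactSupport η) :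
    SmoothBdd (fun p : Sp d × ℝ => η p.2) := by
  have bd : ∀ {f : ℝ → ℝ}, Continuous f → HasCompactSupport f → ∀ c : ℝ,
      ∃ C, ∀ p : Sp d × ℝ, |c * f p.2| ≤ C := fun {f} hf hfc c => by
    obtain ⟨C, hC⟩ := hf.bounded_above_of_compact_support hfc
    exact ⟨|c| * C, fun p => by
      rw [abs_mul]; exact mul_le_mul_of_nonneg_left (hC _) (abs_nonneg c)⟩
  have h1 : ContDiff ℝ ∞ (deriv η) := (contDiff_infty_iff_deriv.1 hη).2
  have h2 : ContDiff ℝ ∞ (deriv (deriv η)) := (contDiff_infty_iff_deriv.1 h1).2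
  refine ⟨hη.comp contDiff_snd, ?_, fun v => ?_, fun u v => ?_⟩
  · simpa using bd hη.continuous hc 1
  · rw [dd_comp_snd hη]
    exact bd h1.continuous hc.deriv _
  · rw [dd_comp_snd hη, dd_comp_snd (η := fun s => v.2 * deriv η s) (contDiff_const.mul h1)]
    have : ∀ p : Sp d × ℝ, u.2 * deriv (fun s => v.2 * deriv η s) p.2
        = (u.2 * v.2) * deriv (deriv η) p.2 := fun p => by
      rw [deriv_const_mul_field]
      ring
    simp_rw [this]
    exact bd h2.continuous hc.deriv.deriv _

/-- A bounded terminal function equal to `exp (λ s)` at all times in `[0, t]`. -/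
lemma exists_energyBound_exp (d : ℕ) {σ lam t : ℝ} (hlam : 0 < lam) (ht : 0 < t) :
    ∃ h : Sp d × ℝ → ℝ, EnergyBound σ lam (Real.exp (2 * (lam * t))) 0 h ∧
      ∀ x, ∀ s ∈ Icc 0 t, h (x, s) = Real.exp (lam * s) := by
  -- The outer radius `2t` accounts for the bound `e^{2λt}`. Since `h` does not depend on space, its
  -- energy is `0`.
  let χ : ContDiffBump (0 : ℝ) := ⟨t, 2 * t, ht, by linarith⟩
  set η : ℝ → ℝ := fun s => χ s * Real.exp (lam * s) with hη
  have hηs : ContDiff ℝ ∞ η := χ.contDiff.mul (by fun_prop)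
  refine ⟨fun p => η p.2, ⟨SmoothBdd.comp_snd hηs χ.hasCompactSupport.mul_right, by positivity,
    le_rfl, fun p => ?_, fun k p => ?_⟩, fun x s hs => ?_⟩
  · rw [hη]
    simp only
    rw [abs_mul, abs_of_nonneg χ.nonneg, Real.abs_exp]
    by_cases hp : p.2 ∈ Metric.ball 0 (2 * t)
    · rw [mem_ball_zero_iff, Real.norm_eq_abs, abs_lt] at hp
      refine (mul_le_of_le_one_left (Real.exp_pos _).le χ.le_one).trans (Real.exp_le_exp.2 ?_)
      nlinarith [hp.2]
    · have : χ p.2 = 0 := by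
        rw [← Function.notMem_support, χ.support_eq]
        exact hp
      rw [this, zero_mul]
      positivity
  · rw [dd_comp_snd hηs]
    simp [Res, eS]
  · have : χ s = 1 := χ.one_of_mem_closedBall (by
      rw [mem_closedBall_zero_iff, Real.norm_eq_abs, abs_of_nonneg hs.1]; exact hs.2)
    simp [hη, this]

section

variable {d : ℕ} {Ω : Type*} [MeasurableSpace Ω] {P : Measure Ω} [IsProbabilityMeasure P]
  {B : ℝ≥0 → Ω → Sp d} {a : Sp d} {σ t lam : ℝ}

/-- Induction with `h` general: peeling the last factor replaces `(m, k)` by `(M, 3M)` with `M =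
β(m+k)`, so the sum `m + k` is multiplied by `4β`. -/
lemma IsStandardBrownian.abs_integral_pathProd_le [hl : Fact (0 < lam)]
    (hB : IsStandardBrownian B P) (hm : ∀ t, Measurable (B t))
    (hc : ∀ x, Continuous fun t => B t x) (hσ : 0 < σ) (ht : 0 ≤ t) {n : ℕ}
    {b : Fin n → Sp d × ℝ → ℝ} {β : Fin n → ℝ} (hb : ∀ i, KatoBound σ lam (β i) (b i))
    {α : Fin n → Fin d} (hbt : ∀ i x u, t < u → dd (eS (α i)) (b i) (x, u) = 0)
    {h : Sp d × ℝ → ℝ} {m k : ℝ} (hh : EnergyBound σ lam m k h) :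
    |∫ s in orderedSimplex n t, ∫ x, pathProd B a σ lam (fun i => dd (eS (α i)) (b i)) h s x ∂P|
      ≤ 4 ^ n * (∏ i, β i) * (m + k) := by
  induction n generalizing h m k with
  | zero =>
    have h1 : volume.real (orderedSimplex 0 t) = 1 := by
      have : orderedSimplex 0 t = univ :=
        eq_univ_of_forall fun s => ⟨fun i => i.elim0, fun i => i.elim0⟩
      rw [this, volume_pi, Measure.pi_of_empty _ (0 : Fin 0 → ℝ)]
      simp
    have h2 : ∀ s : Fin 0 → ℝ, ‖∫ x, pathProd B a σ lam
        (fun i => dd (eS (α i)) (b i)) h s x ∂P‖ ≤ m := fun s => by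
      refine (norm_integral_le_of_norm_le_const (C := m) (.of_forall fun x => ?_)).trans (by simp)
      simpa [pathProd, lastTime] using hh.abs_le _
    have h3 := norm_setIntegral_le_of_norm_le_const (volume_orderedSimplex_lt_top 0 t)
      (fun s _ => h2 s)
    rw [h1, mul_one, Real.norm_eq_abs] at h3
    simpa using h3.trans (le_add_of_nonneg_right hh.nonneg_right)
  | succ n ih =>
    have hc' := fun i => (contDiff_dd (hb i).smooth (eS (α i))).continuous
    rw [hB.integral_pathProd_snoc hm hc ht hc' hh.smoothBdd.smooth.continuous
      (fun i => exists_bound (hc' i) (hasCompactSupport_dd (hb i).compact _)) hh.smoothBdd.bdd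
      (hbt (Fin.last n))]
    refine (ih (fun i => hb i.castSucc) (fun i => hbt i.castSucc)
      ((hb (Fin.last n)).energyBound_step hσ hh (α (Fin.last n)))).trans_eq ?_
    rw [Fin.prod_univ_castSucc]
    ring

lemma IsStandardBrownian.abs_integral_prod_dd_le [hl : Fact (0 < lam)]
    (hB : IsStandardBrownian B P) (hm : ∀ t, Measurable (B t))
    (hc : ∀ x, Continuous fun t => B t x) (hσ : 0 < σ) (ht : 0 < t) {n : ℕ}
    {b : Fin n → Sp d × ℝ → ℝ} {β : Fin n → ℝ} (hb : ∀ i, KatoBound σ lam (β i) (b i))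
    {α : Fin n → Fin d} (hbt : ∀ i x u, t < u → dd (eS (α i)) (b i) (x, u) = 0) :
    |∫ s in orderedSimplex n t, ∫ x, ∏ i, dd (eS (α i)) (b i) (pos B a σ (s i) x) ∂P|
      ≤ 4 ^ n * (∏ i, β i) * Real.exp (2 * (lam * t)) := by
  obtain ⟨h, hh, hexp⟩ := exists_energyBound_exp d (σ := σ) hl.out ht
  have key := hB.abs_integral_pathProd_le (a := a) hm hc hσ ht.le hb hbt hh
  rw [add_zero] at key
  convert key using 2
  refine setIntegral_congr_fun (measurableSet_orderedSimplex n t) fun s hs => ?_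
  simp only [pathProd]
  congr 1 with x
  rw [pos, hexp _ _ (lastTime_mem ht.le hs), ← Real.exp_add]
  simp

end

end DavieBound

/-! ### Mollification, and extension of slab functions to all times. -/

namespace DavieBound

open Filter Topology
open scoped ContDiff

section Mollify

variable {d : ℕ}

instance isAddHaarMeasure_volume_prod : (volume : Measure (Sp d × ℝ)).IsAddHaarMeasure :=
  Measure.prod.instIsAddHaarMeasure _ _

/-- The convolution of `F` with a normalized bump function. -/
noncomputable def moll (φ : ContDiffBump (0 : Sp d × ℝ)) (F : Sp d × ℝ → ℝ) : Sp d × ℝ → ℝ :=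
  convolution (φ.normed volume) F (ContinuousLinearMap.lsmul ℝ ℝ) volume

variable {φ : ContDiffBump (0 : Sp d × ℝ)} {F G : Sp d × ℝ → ℝ}

lemma moll_apply (p : Sp d × ℝ) : moll φ F p = ∫ w, φ.normed volume w * F (p - w) := rfl

lemma contDiff_moll (hF : Continuous F) : ContDiff ℝ ∞ (moll φ F) :=
  φ.hasCompactSupport_normed.contDiff_convolution_left _ φ.contDiff_normed
    hF.locallyIntegrable

lemma integrable_normed_mul (hF : Continuous F) {C : ℝ} (hC : ∀ p, |F p| ≤ C) (p : Sp d × ℝ) :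
    Integrable fun w => φ.normed volume w * F (p - w) :=
  φ.integrable_normed.mul_bdd (c := C) (by fun_prop) (.of_forall fun w => hC _)

lemma abs_moll_le {C : ℝ} (hC : ∀ p, |F p| ≤ C) (p : Sp d × ℝ) :
    |moll φ F p| ≤ C := by
  have h0 : ∀ w, 0 ≤ φ.normed volume w := φ.nonneg_normed
  rw [moll_apply]
  refine (abs_integral_le_of_abs_le (φ.integrable_normed.mul_const C)
    (.of_forall fun w => ?_)).trans ?_
  · rw [abs_mul, abs_of_nonneg (h0 w)]
    exact mul_le_mul_of_nonneg_left (hC _) (h0 w)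
  · rw [integral_mul_const, φ.integral_normed, one_mul]

lemma moll_eq_zero (hφ : φ.rOut ≤ 1) {R : ℝ} (hF : ∀ x s, R < ‖x‖ → F (x, s) = 0) {x : Sp d}
    (hx : R + 1 < ‖x‖) (s : ℝ) : moll φ F (x, s) = 0 := by
  rw [moll_apply]
  refine integral_eq_zero_of_ae (.of_forall fun w => ?_)
  by_cases hw : w ∈ Metric.ball 0 φ.rOut
  · rw [mem_ball_zero_iff] at hw
    have h1 : ‖w.1‖ ≤ ‖w‖ := norm_fst_le w
    have h2 : ‖x‖ - ‖w.1‖ ≤ ‖x - w.1‖ := norm_sub_norm_le _ _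
    simp [show (x, s) - w = (x - w.1, s - w.2) from rfl, hF (x - w.1) _ (by linarith)]
  · rw [← φ.support_normed_eq (μ := volume), Function.notMem_support] at hw
    simp [hw]

/-- Only the derivative along `e` is assumed: a function frozen in time outside the slab need not be
differentiable in time at `0` and `T`. -/
lemma dd_moll (hF : Continuous F) {C : ℝ} (hFC : ∀ p, |F p| ≤ C) (hG : Continuous G) {D : ℝ}
    (hGD : ∀ p, |G p| ≤ D) {e : Sp d × ℝ}
    (hd : ∀ p h, HasDerivAt (fun h : ℝ => F (p + h • e)) (G (p + h • e)) h) :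
    dd e (moll φ F) = moll φ G := by
  funext p
  have h1 : HasDerivAt (fun h : ℝ => moll φ F (p + h • e)) (dd e (moll φ F) p) 0 := by
    have h2 : HasFDerivAt (moll φ F) (fderiv ℝ (moll φ F) p) (p + (0 : ℝ) • e) := by
      simpa using ((contDiff_moll hF).differentiable (by simp) p).hasFDerivAt
    have h3 : HasDerivAt (fun h : ℝ => p + h • e) e 0 := by
      simpa using ((hasDerivAt_id (0 : ℝ)).smul_const e).const_add p
    exact h2.comp_hasDerivAt 0 h3
  have h4 := (hasDerivAt_integral_of_dominated_loc_of_deriv_le (μ := (volume : Measure (Sp d × ℝ)))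
    (F := fun (h : ℝ) w => φ.normed volume w * F (p + h • e - w))
    (F' := fun (h : ℝ) w => φ.normed volume w * G (p + h • e - w)) (x₀ := 0)
    (bound := fun w => φ.normed volume w * D) (s := univ) univ_mem
    (.of_forall fun h => (integrable_normed_mul hF hFC _).aestronglyMeasurable)
    (integrable_normed_mul hF hFC _) (integrable_normed_mul hG hGD _).aestronglyMeasurable
    (.of_forall fun w h _ => by
      rw [norm_mul, Real.norm_eq_abs, Real.norm_eq_abs, abs_of_nonneg (φ.nonneg_normed w)]
      exact mul_le_mul_of_nonneg_left (hGD _) (φ.nonneg_normed w))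
    (φ.integrable_normed.mul_const D)
    (.of_forall fun w h _ => by
      have := (hd (p - w) h).const_mul (φ.normed volume w)
      simpa only [add_sub_right_comm] using this)).2
  have h5 : HasDerivAt (fun h : ℝ => moll φ F (p + h • e)) (moll φ G p) 0 := by
    simpa [moll_apply] using h4
  exact h1.unique h5

lemma tendstoUniformly_moll {φ : ℕ → ContDiffBump (0 : Sp d × ℝ)}
    (hφ : Tendsto (fun j => (φ j).rOut) atTop (𝓝 0)) (hF : UniformContinuous F) :
    TendstoUniformly (fun j => moll (φ j) F) F atTop := by
  rw [Metric.tendstoUniformly_iff]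
  intro ε hε
  obtain ⟨δ, hδ, h⟩ := Metric.uniformContinuous_iff.1 hF (ε / 2) (by positivity)
  filter_upwards [hφ.eventually_lt_const hδ] with j hj p
  rw [dist_comm]
  refine (ContDiffBump.dist_normed_convolution_le (φ := φ j) (ε := ε / 2)
    hF.continuous.aestronglyMeasurable fun x hx => (h ?_).le).trans_lt (by linarith)
  exact (Metric.mem_ball.1 hx).trans hj

end Mollify

section Extension

variable {d : ℕ} {T : ℝ} {b : Sp d → ℝ → ℝ}

lemma uniformContinuous_comp_projIcc (hT : 0 ≤ T) {f : Sp d × Icc (0 : ℝ) T → ℝ}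
    (hf : Continuous f) {R : ℝ} (hR : ∀ x s, R < ‖x‖ → f (x, s) = 0) :
    UniformContinuous fun p : Sp d × ℝ => f (p.1, projIcc 0 T hT p.2) := by
  have hc : HasCompactSupport f := by
    refine HasCompactSupport.intro ((isCompact_closedBall (0 : Sp d) R).prod isCompact_univ)
      fun p hp => hR p.1 p.2 ?_
    simpa using hp
  refine (hc.uniformContinuous_of_continuous hf).comp ?_
  exact uniformContinuous_fst.prodMk
    ((LipschitzWith.projIcc hT).uniformContinuous.comp uniformContinuous_snd)

/-- A function on the slab, frozen in time outside it, with its spatial derivatives. -/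
structure IsExtension (T R : ℝ) (b : Sp d → ℝ → ℝ) (F : Sp d × ℝ → ℝ)
    (G : Fin d → Sp d × ℝ → ℝ) : Prop where
  unif : UniformContinuous F
  unif_deriv : ∀ k, UniformContinuous (G k)
  eq_zero : ∀ x s, R < ‖x‖ → F (x, s) = 0
  bdd : ∃ C, ∀ p, |F p| ≤ C
  bdd_deriv : ∃ C, ∀ k p, |G k p| ≤ C
  hasDerivAt : ∀ k p h, HasDerivAt (fun h : ℝ => F (p + h • eS k)) (G k (p + h • eS k)) h
  eqOn : ∀ x, ∀ s ∈ Icc 0 T, F (x, s) = b x s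

lemma IsExtension.deriv_eq {R : ℝ} {F : Sp d × ℝ → ℝ} {G : Fin d → Sp d × ℝ → ℝ}
    (h : IsExtension T R b F G) (k : Fin d) (x : Sp d) {s : ℝ} (hs : s ∈ Icc 0 T) :
    G k (x, s) = spatialDeriv k b x s := by
  have h1 := h.hasDerivAt k (x, s) 0
  have e : ∀ u : ℝ, F ((x, s) + u • eS k) = b (x + u • EuclideanSpace.single k 1) s := fun u => by
    rw [← h.eqOn _ s hs]
    simp [eS]
  simp_rw [e] at h1
  simpa [spatialDeriv, lineDeriv] using h1.deriv.symm

lemma exists_bound_of_continuous_slab {f : Sp d × Icc (0 : ℝ) T → ℝ}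
    (hf : Continuous f) {R : ℝ} (hR : ∀ x s, R < ‖x‖ → f (x, s) = 0) : ∃ C, ∀ p, |f p| ≤ C := by
  have hc : HasCompactSupport f := by
    refine HasCompactSupport.intro ((isCompact_closedBall (0 : Sp d) R).prod isCompact_univ)
      fun p hp => hR p.1 p.2 ?_
    simpa using hp
  exact hf.bounded_above_of_compact_support hc

lemma IsC1CompactlySupported.exists_isExtension (hT : 0 < T) (hb : IsC1CompactlySupported T b) :
    ∃ R F G, IsExtension T R b F G := by
  set S : Set (Sp d × ℝ) := univ ×ˢ Icc 0 T
  set f : Sp d × ℝ → ℝ := fun p => b p.1 p.2 with hf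
  have hS : UniqueDiffOn ℝ S := uniqueDiffOn_univ.prod (uniqueDiffOn_Icc hT)
  set ι : Sp d × Icc (0 : ℝ) T → Sp d × ℝ := fun p => (p.1, p.2)
  have hι : Continuous ι := by fun_prop
  have hιS : ∀ p, ι p ∈ S := fun p => ⟨mem_univ _, p.2.2⟩
  set F' : Sp d × Icc (0 : ℝ) T → ℝ := fun p => f (ι p) with hF'
  set G' : Fin d → Sp d × Icc (0 : ℝ) T → ℝ := fun k p => fderivWithin ℝ f S (ι p) (eS k) with hG'
  have hF'c : Continuous F' := hb.contDiffOn.continuousOn.comp_continuous hι hιS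
  have hG'c : ∀ k, Continuous (G' k) := fun k =>
    ((hb.contDiffOn.continuousOn_fderivWithin hS le_rfl).comp_continuous hι hιS).clm_apply
      continuous_const
  -- Spatial lines through the slab stay inside it, so the derivative within the slab is a genuine
  -- directional derivative, even at times `0` and `T`.
  have hderiv : ∀ k x (s : Icc (0 : ℝ) T) (h : ℝ),
      HasDerivAt (fun h : ℝ => F' (x + h • EuclideanSpace.single k 1, s))
        (G' k (x + h • EuclideanSpace.single k 1, s)) h := fun k x s h => by
    have h1 := ((hb.contDiffOn.differentiableOn one_ne_zero) _
      (hιS (x + h • EuclideanSpace.single k 1, s))).hasFDerivWithinAt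
    have h2 : HasDerivAt (fun h : ℝ => ((x + h • EuclideanSpace.single k 1, (s : ℝ)) : Sp d × ℝ))
        (eS k) h := by
      have := (((hasDerivAt_id h).smul_const (EuclideanSpace.single k (1 : ℝ))).const_add x)
      simpa [eS] using this.prodMk (hasDerivAt_const h (s : ℝ))
    exact h1.comp_hasDerivAt h h2
      (.of_forall fun u => hιS (x + u • EuclideanSpace.single k 1, s))
  obtain ⟨R, hR⟩ : ∃ R, ∀ x s, R < ‖x‖ → F' (x, s) = 0 := by
    obtain ⟨R, hR⟩ := (hb.hasCompactSupport.isCompact.image continuous_fst).isBounded.exists_norm_le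
    refine ⟨R, fun x s hx => ?_⟩
    by_contra h
    exact absurd (hR x ⟨(x, s), subset_tsupport _ h, rfl⟩) (not_le.2 hx)
  have hGR : ∀ k x s, R < ‖x‖ → G' k (x, s) = 0 := fun k x s hx => by
    have h1 := hderiv k x s 0
    have h2 : (fun h : ℝ => F' (x + h • EuclideanSpace.single k 1, s)) =ᶠ[𝓝 0] fun _ => 0 := by
      have h3 : Tendsto (fun h : ℝ => ‖x + h • EuclideanSpace.single k (1 : ℝ)‖) (𝓝 0) (𝓝 ‖x‖) :=
        Continuous.tendsto' (by fun_prop) _ _ (by simp)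
      filter_upwards [h3.eventually_const_lt hx] with h hh
      exact hR _ _ hh
    have h3 := h1.unique ((hasDerivAt_const (0 : ℝ) (0 : ℝ)).congr_of_eventuallyEq h2)
    simpa using h3
  refine ⟨R, fun p => F' (p.1, projIcc 0 T hT.le p.2), fun k p => G' k (p.1, projIcc 0 T hT.le p.2),
    uniformContinuous_comp_projIcc hT.le hF'c hR,
    fun k => uniformContinuous_comp_projIcc hT.le (hG'c k) (hGR k),
    fun x s hx => hR _ _ hx, ?_, ?_, fun k p h => ?_, fun x s hs => ?_⟩
  · obtain ⟨C, hC⟩ := exists_bound_of_continuous_slab hF'c hR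
    exact ⟨C, fun p => hC _⟩
  · choose C hC using fun k => exists_bound_of_continuous_slab (hG'c k) (hGR k)
    refine ⟨∑ k, |C k|, fun k p => (hC k _).trans ((le_abs_self _).trans ?_)⟩
    exact Finset.single_le_sum (f := fun k => |C k|) (fun i _ => abs_nonneg _) (Finset.mem_univ k)
  · simpa [eS] using hderiv k p.1 (projIcc 0 T hT.le p.2) h
  · simp [hF', f, ι, projIcc_of_mem hT.le hs]

end Extension

end DavieBound

/-! ### Slice norms and smooth approximation. -/

namespace DavieBound

open Filter Topology
open scoped ContDiff

section Slices

variable {d : ℕ} {r q : ℝ≥0∞} {T R : ℝ} {b : Sp d → ℝ → ℝ} {F : Sp d × ℝ → ℝ}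
  {G : Fin d → Sp d × ℝ → ℝ}

/-- The norm in `L^r` of the indicator function of a ball. -/
noncomputable def ballConst (d : ℕ) (r : ℝ≥0∞) (R : ℝ) : ℝ :=
  (volume (Metric.closedBall (0 : Sp d) R) ^ r.toReal⁻¹).toReal

lemma ballConst_nonneg (d : ℕ) (r : ℝ≥0∞) (R : ℝ) : 0 ≤ ballConst d r R := ENNReal.toReal_nonneg

lemma eLpNorm_le_ballConst {u : Sp d → ℝ} {ε : ℝ} (hu : ∀ x, |u x| ≤ ε)
    (h0 : ∀ x, R < ‖x‖ → u x = 0) (r : ℝ≥0∞) :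
    eLpNorm u r volume ≤ ENNReal.ofReal (ballConst d r R * ε) := by
  have hs : Function.support u ⊆ Metric.closedBall (0 : Sp d) R := fun x hx => by
    rw [mem_closedBall_zero_iff]
    exact not_lt.1 fun h => hx (h0 x h)
  rw [← eLpNorm_restrict_eq_of_support_subset hs, ENNReal.ofReal_mul (ballConst_nonneg d r R),
    ballConst, ENNReal.ofReal_toReal]
  · exact (eLpNorm_le_of_ae_bound (.of_forall hu)).trans_eq (by simp)
  · exact ENNReal.rpow_ne_top_of_nonneg (by positivity)
      (isCompact_closedBall (0 : Sp d) R).measure_lt_top.ne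

/-- The norm in `L^r` of the slice at time `s`. -/
noncomputable def sliceNorm (r : ℝ≥0∞) (F : Sp d × ℝ → ℝ) (s : ℝ) : ℝ :=
  (eLpNorm (fun x => F (x, s)) r volume).toReal

lemma sliceNorm_nonneg (r : ℝ≥0∞) (F : Sp d × ℝ → ℝ) (s : ℝ) : 0 ≤ sliceNorm r F s :=
  ENNReal.toReal_nonneg

lemma IsExtension.ofReal_sliceNorm (h : IsExtension T R b F G) (r : ℝ≥0∞) (s : ℝ) :
    ENNReal.ofReal (sliceNorm r F s) = eLpNorm (fun x => F (x, s)) r volume := by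
  obtain ⟨C, hC⟩ := h.bdd
  exact ENNReal.ofReal_toReal ((eLpNorm_le_ballConst (fun x => hC (x, s))
    (fun x => h.eq_zero x s) r).trans_lt ENNReal.ofReal_lt_top).ne

lemma IsExtension.sliceNorm_le_add (h : IsExtension T R b F G) (hr : 1 ≤ r) {s s' ε : ℝ}
    (hε : ∀ x, |F (x, s) - F (x, s')| ≤ ε) :
    sliceNorm r F s ≤ sliceNorm r F s' + ballConst d r R * ε := by
  have hε0 : 0 ≤ ε := (abs_nonneg _).trans (hε 0)
  have hF := h.unif.continuous
  rw [← ENNReal.ofReal_le_ofReal_iff (add_nonneg (sliceNorm_nonneg r F s')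
    (mul_nonneg (ballConst_nonneg d r R) hε0)), ENNReal.ofReal_add (sliceNorm_nonneg r F s')
    (mul_nonneg (ballConst_nonneg d r R) hε0), h.ofReal_sliceNorm, h.ofReal_sliceNorm]
  have e : (fun x => F (x, s)) = (fun x => F (x, s')) + fun x => F (x, s) - F (x, s') := by
    funext x
    simp
  rw [e]
  refine (eLpNorm_add_le (Continuous.aestronglyMeasurable (by fun_prop))
    (Continuous.aestronglyMeasurable (by fun_prop)) hr).trans (add_le_add_right ?_ _)
  exact eLpNorm_le_ballConst hε (fun x hx => by simp [h.eq_zero x _ hx]) r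

/-- Slices live on one fixed ball, so their uniform continuity in time becomes continuity in `L^r`.
-/
lemma IsExtension.continuous_sliceNorm (h : IsExtension T R b F G) (hr : 1 ≤ r) :
    Continuous (sliceNorm r F) := by
  rw [Metric.continuous_iff]
  intro s ε hε
  have hV := ballConst_nonneg d r R
  set η : ℝ := ε / (ballConst d r R + 1) with hη
  have hη0 : 0 < η := by positivity
  have hlt : ballConst d r R * η < ε := by
    rw [hη, mul_div_assoc', div_lt_iff₀ (by positivity)]
    nlinarith
  obtain ⟨δ, hδ, hd⟩ := Metric.uniformContinuous_iff.1 h.unif η hη0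
  refine ⟨δ, hδ, fun s' hs' => ?_⟩
  have hd' : ∀ x : Sp d, |F (x, s') - F (x, s)| ≤ η := fun x => by
    rw [← Real.dist_eq]
    exact (hd (by rwa [Prod.dist_eq, dist_self, max_eq_right dist_nonneg])).le
  have h1 := h.sliceNorm_le_add hr hd'
  have h2 := h.sliceNorm_le_add hr (s := s) (s' := s') fun x => by
    rw [abs_sub_comm]; exact hd' x
  rw [Real.dist_eq, abs_lt]
  constructor <;> linarith

lemma IsExtension.mixedNorm_eq (h : IsExtension T R b F G) (r q : ℝ≥0∞) :
    mixedNorm T r q b = eLpNorm (sliceNorm r F) q (volume.restrict (Icc 0 T)) := by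
  refine eLpNorm_congr_enorm_ae ?_
  filter_upwards [ae_restrict_mem measurableSet_Icc] with s hs
  rw [enorm_eq_self, ← enorm_norm, Real.norm_of_nonneg (sliceNorm_nonneg r F s),
    Real.enorm_of_nonneg (sliceNorm_nonneg r F s), h.ofReal_sliceNorm]
  simp_rw [h.eqOn _ s hs]

lemma IsExtension.mixedNorm_ne_top (h : IsExtension T R b F G) (hr : 1 ≤ r) (q : ℝ≥0∞) :
    mixedNorm T r q b ≠ ⊤ := by
  rw [h.mixedNorm_eq]
  obtain ⟨C, hC⟩ := isCompact_Icc.exists_bound_of_continuousOn (s := Icc 0 T)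
    (h.continuous_sliceNorm hr).continuousOn
  refine ((eLpNorm_le_of_ae_bound (C := C) ?_).trans_lt (ENNReal.mul_lt_top
    (ENNReal.rpow_lt_top_of_nonneg (by positivity) ?_) ENNReal.ofReal_lt_top)).ne
  · filter_upwards [ae_restrict_mem measurableSet_Icc] with s hs using hC s hs
  · simp

end Slices

section Approximation

variable {d : ℕ} {r q : ℝ≥0∞} {T R t : ℝ} {b : Sp d → ℝ → ℝ} {F : Sp d × ℝ → ℝ}
  {G : Fin d → Sp d × ℝ → ℝ}

lemma IsExtension.exists_moll_close (h : IsExtension T R b F G) {ε : ℝ} (hε : 0 < ε) :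
    ∃ φ : ContDiffBump (0 : Sp d × ℝ), φ.rOut ≤ 1 ∧ (∀ p, |moll φ F p - F p| ≤ ε) ∧
      ∀ k p, |moll φ (G k) p - G k p| ≤ ε := by
  let φ : ℕ → ContDiffBump (0 : Sp d × ℝ) := fun j =>
    ⟨1 / (j + 1) / 2, 1 / (j + 1), by positivity, half_lt_self (by positivity)⟩
  have hφ : Tendsto (fun j => (φ j).rOut) atTop (𝓝 0) := tendsto_one_div_add_atTop_nhds_zero_nat
  have close : ∀ {f : Sp d × ℝ → ℝ}, UniformContinuous f →
      ∀ᶠ j in atTop, ∀ p, |moll (φ j) f p - f p| ≤ ε := fun {f} hf => by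
    filter_upwards [Metric.tendstoUniformly_iff.1 (tendstoUniformly_moll hφ hf) ε hε] with j hj p
    rw [← Real.dist_eq, dist_comm]
    exact (hj p).le
  obtain ⟨j, h1, h2, h3⟩ := ((hφ.eventually_le_const one_pos).and
    ((close h.unif).and (eventually_all.2 fun k => close (h.unif_deriv k)))).exists
  exact ⟨φ j, h1, h2, h3⟩

/-- Approximation of a function on the slab by test functions, without increasing the mixed norm
by more than `ε`. -/
theorem IsExtension.exists_smooth_approx (h : IsExtension T R b F G) (ht : 0 < t) (htT : t ≤ T)
    (hr : 1 ≤ r) (hq : 1 ≤ q) {C : ℝ} (hC : ∀ k p, |G k p| ≤ C) {ε : ℝ} (hε : 0 < ε) :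
    ∃ (f : Sp d × ℝ → ℝ) (H : ℝ → ℝ), ContDiff ℝ ∞ f ∧ HasCompactSupport f ∧
      (∀ k x u, t < u → dd (eS k) f (x, u) = 0) ∧ (∀ k p, |dd (eS k) f p| ≤ C) ∧
      (∀ k x, ∀ s ∈ Icc ε (t - ε), |dd (eS k) f (x, s) - G k (x, s)| ≤ ε) ∧
      AEStronglyMeasurable H volume ∧ (∀ s, 0 ≤ H s) ∧
      (∀ s, eLpNorm (fun x => f (x, s)) r volume ≤ ENNReal.ofReal (H s)) ∧
      eLpNorm H q volume ≤ ENNReal.ofReal ((mixedNorm T r q b).toReal + ε) := by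
  -- A mollifier of radius at most `1` enlarges the spatial support to radius `R + 1`. The choice of
  -- `η` makes a uniform error `η` cost at most `ε` in the mixed norm.
  set V := ballConst d r (R + 1) with hVdef
  have hV : 0 ≤ V := ballConst_nonneg _ _ _
  set L : ℝ := (volume (Icc 0 t) ^ q.toReal⁻¹).toReal with hL
  have hL0 : 0 ≤ L := ENNReal.toReal_nonneg
  set η : ℝ := ε / (L * V + 1) with hη
  have hη0 : 0 < η := by positivity
  have hηε : η ≤ ε := div_le_self hε.le (by nlinarith [mul_nonneg hL0 hV])
  have hLVη : L * (V * η) ≤ ε := by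
    rw [hη, mul_div_assoc', mul_div_assoc', div_le_iff₀ (by positivity)]
    nlinarith
  obtain ⟨φ, hφ1, hφF, hφG⟩ := h.exists_moll_close hη0
  -- The maximum with `t/4` keeps the inner radius positive when `ε` is large compared with `t`.
  let χ : ContDiffBump (t / 2) := ⟨max (t / 4) (t / 2 - ε), t / 2, by
    apply lt_max_of_lt_left; linarith, by apply max_lt <;> linarith⟩
  have hχs : ContDiff ℝ ∞ χ := χ.contDiff
  have hχ0 : ∀ s, s ∉ Ioo 0 t → χ s = 0 := fun s hs => by
    rw [← Function.notMem_support, χ.support_eq, Real.ball_eq_Ioo]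
    simpa [χ] using hs
  have hχ1 : ∀ s ∈ Icc ε (t - ε), χ s = 1 := fun s hs => χ.one_of_mem_closedBall (by
    rw [Real.closedBall_eq_Icc]
    have : t / 2 - ε ≤ max (t / 4) (t / 2 - ε) := le_max_right _ _
    constructor <;> simp only [χ] <;> linarith [hs.1, hs.2])
  have hF := h.unif.continuous
  obtain ⟨D, hD⟩ := h.bdd
  have hM : ContDiff ℝ ∞ (moll φ F) := contDiff_moll hF
  have hdd : ∀ k p, dd (eS k) (fun p => χ p.2 * moll φ F p) p = χ p.2 * moll φ (G k) p :=
    fun k p => by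
    rw [dd_mul (f := fun p => χ p.2) (hχs.comp contDiff_snd) hM, dd_comp_snd hχs, dd_moll hF hD
      (h.unif_deriv k).continuous (hC k) (h.hasDerivAt k)]
    simp [eS]
  have hN0 := sliceNorm_nonneg r F
  refine ⟨fun p => χ p.2 * moll φ F p, (Icc 0 t).indicator fun s => sliceNorm r F s + V * η,
    (hχs.comp contDiff_snd).mul hM, ?_, fun k x u hu => ?_, fun k p => ?_, fun k x s hs => ?_,
    ?_, fun s => ?_, fun s => ?_, ?_⟩
  · refine HasCompactSupport.intro ((isCompact_closedBall (0 : Sp d) (R + 1)).prod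
      (isCompact_Icc (a := 0) (b := t))) fun p hp => ?_
    rw [mem_prod, not_and_or, mem_closedBall_zero_iff, not_le] at hp
    rcases hp with hp | hp
    · rw [show p = (p.1, p.2) from rfl, moll_eq_zero hφ1 h.eq_zero hp, mul_zero]
    · rw [hχ0 _ fun h' => hp (Ioo_subset_Icc_self h'), zero_mul]
  · rw [hdd, hχ0 _ fun h' => (h'.2.trans hu).false, zero_mul]
  · rw [hdd, abs_mul, abs_of_nonneg χ.nonneg]
    exact (mul_le_of_le_one_left (abs_nonneg _) χ.le_one).trans (abs_moll_le (hC k) p)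
  · rw [hdd, hχ1 s hs, one_mul]
    exact (hφG k _).trans hηε
  · exact (((h.continuous_sliceNorm hr).add continuous_const).aestronglyMeasurable).indicator
      measurableSet_Icc
  · exact indicator_nonneg (fun s _ => add_nonneg (hN0 s) (by positivity)) s
  · by_cases hs : s ∈ Icc 0 t
    · rw [indicator_of_mem hs, ENNReal.ofReal_add (hN0 s) (by positivity), h.ofReal_sliceNorm]
      calc eLpNorm (fun x => χ s * moll φ F (x, s)) r volume
          ≤ eLpNorm ((fun x => F (x, s)) + fun x => moll φ F (x, s) - F (x, s)) r volume := by
            refine eLpNorm_mono fun x => ?_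
            simp only [Pi.add_apply, add_sub_cancel, norm_mul, Real.norm_of_nonneg χ.nonneg]
            exact mul_le_of_le_one_left (norm_nonneg _) χ.le_one
        _ ≤ _ := (eLpNorm_add_le (Continuous.aestronglyMeasurable (by fun_prop))
            (Continuous.aestronglyMeasurable (by have := hM.continuous; fun_prop)) hr).trans
            (add_le_add_right (eLpNorm_le_ballConst (fun x => hφF _) (fun x hx => by
              rw [moll_eq_zero hφ1 h.eq_zero hx, h.eq_zero x s (by linarith), sub_zero]) r) _)
    · have : χ s = 0 := hχ0 _ fun h' => hs (Ioo_subset_Icc_self h')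
      simp [this]
  · rw [eLpNorm_indicator_eq_eLpNorm_restrict measurableSet_Icc,
      ENNReal.ofReal_add ENNReal.toReal_nonneg hε.le,
      ENNReal.ofReal_toReal (h.mixedNorm_ne_top hr q), h.mixedNorm_eq]
    refine (eLpNorm_add_le (h.continuous_sliceNorm hr).aestronglyMeasurable
      aestronglyMeasurable_const hq).trans (add_le_add (eLpNorm_mono_measure _
        (Measure.restrict_mono_set _ (Icc_subset_Icc_right htT))) ?_)
    refine (eLpNorm_le_of_ae_bound (C := V * η) (.of_forall fun s => ?_)).trans ?_
    · exact (Real.norm_of_nonneg (by positivity)).le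
    · have hvol : volume (Icc 0 t) ^ q.toReal⁻¹ = ENNReal.ofReal L :=
        (ENNReal.ofReal_toReal (ENNReal.rpow_ne_top_of_nonneg (by positivity) (by simp))).symm
      rw [Measure.restrict_apply_univ, hvol, ← ENNReal.ofReal_mul hL0]
      exact ENNReal.ofReal_le_ofReal hLVη

end Approximation

end DavieBound

/-! ### Passage to the limit. -/

namespace DavieBound

open Filter Topology

section

variable {d : ℕ} {Ω : Type*} [MeasurableSpace Ω] {P : Measure Ω} [IsProbabilityMeasure P]
  {B : ℝ≥0 → Ω → Sp d} {a : Sp d} {σ t : ℝ}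

lemma integrable_prod_pos (hm : ∀ t, Measurable (B t)) (hc : ∀ x, Continuous fun t => B t x)
    {n : ℕ} (ht : 0 ≤ t) {g : Fin n → Sp d × ℝ → ℝ} (hg : ∀ i, Continuous (g i))
    (hgb : ∀ i, ∃ C, ∀ p, |g i p| ≤ C) :
    Integrable (fun p : (Fin n → ℝ) × Ω => ∏ i, g i (pos B a σ (p.1 i) p.2))
      ((volume.restrict (orderedSimplex n t)).prod P) := by
  have := integrable_pathProd (P := P) (a := a) (σ := σ) (lam := 0) (h := fun _ => 1) hm hc le_rfl
    ht hg continuous_const hgb ⟨1, by simp⟩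
  simpa [pathProd] using this

/-- Coordinate hyperplanes are null. This matters because the time cutoffs give pointwise
convergence only on the open interval. -/
lemma ae_mem_Ioo_of_orderedSimplex (n : ℕ) (t : ℝ) :
    ∀ᵐ s ∂(volume.restrict (orderedSimplex n t)), ∀ i, s i ∈ Ioo 0 t := by
  have h1 : ∀ c : ℝ, ∀ᵐ s ∂(volume : Measure (Fin n → ℝ)), ∀ i, s i ≠ c := fun c =>
    eventually_all.2 fun i => Measure.ae_eval_ne (fun _ : Fin n => (volume : Measure ℝ)) i c
  filter_upwards [ae_restrict_mem (measurableSet_orderedSimplex n t),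
    ae_restrict_of_ae (h1 0), ae_restrict_of_ae (h1 t)] with s hs h0 h2 i
  exact ⟨lt_of_le_of_ne (hs.2 i).1 (h0 i).symm, lt_of_le_of_ne (hs.2 i).2 (h2 i)⟩

lemma volume_orderedSimplex_zero {n : ℕ} (hn : 1 ≤ n) : volume (orderedSimplex n 0) = 0 := by
  have := ae_mem_Ioo_of_orderedSimplex n 0
  have h2 : ∀ᵐ _ ∂(volume.restrict (orderedSimplex n 0)), False := by
    filter_upwards [this] with s hs
    simpa using hs ⟨0, hn⟩
  simpa using h2

lemma IsStandardBrownian.abs_integral_prod_spatialDeriv_le (hB : IsStandardBrownian B P)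
    (hm : ∀ t, Measurable (B t)) (hc : ∀ x, Continuous fun t => B t x) (hσ : 0 < σ) {T : ℝ}
    (hT : 0 < T) (ht : 0 < t) (htT : t ≤ T) {lam : ℝ} [hl : Fact (0 < lam)] {r q : ℝ≥0∞}
    (hr2 : 2 ≤ r) (hq : 2 < q) (hδ : 0 < delta1 d r q) {n : ℕ} {b : Fin n → Sp d → ℝ → ℝ}
    (hb : ∀ i, IsC1CompactlySupported T (b i)) (α : Fin n → Fin d) :
    |∫ ω, (∫ s in orderedSimplex n t,
        ∏ i, spatialDeriv (α i) (b i) (a + σ • B (s i).toNNReal ω) (s i)) ∂P|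
      ≤ 4 ^ n * (∏ i, katoConst d r q * σ ^ (-(dimRatio d r + 1)) * lam ^ (-delta1 d r q)
          * (mixedNorm T r q (b i)).toReal) * Real.exp (2 * (lam * t)) := by
  choose R F G hE using fun i => (hb i).exists_isExtension hT
  choose C hC using fun i => (hE i).bdd_deriv
  have hε : ∀ j : ℕ, (0 : ℝ) < 1 / (j + 1) := fun j => by positivity
  choose f H hfs hfc hft hfC hfG hHm hH0 hfH hHq using fun (i : Fin n) (j : ℕ) =>
    (hE i).exists_smooth_approx ht htT (one_le_two.trans hr2) (one_le_two.trans hq.le) (hC i)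
      (hε j)
  set g : ℕ → Fin n → Sp d × ℝ → ℝ := fun j i => dd (eS (α i)) (f i j) with hg
  have hgc : ∀ j i, Continuous (g j i) := fun j i => (contDiff_dd (hfs i j) _).continuous
  have hgb : ∀ j i p, |g j i p| ≤ C i := fun j i p => hfC i j _ p
  have hGc : ∀ i, Continuous (G i (α i)) := fun i => ((hE i).unif_deriv _).continuous
  have hint := integrable_prod_pos (P := P) (a := a) (σ := σ) hm hc ht.le hGc
    (fun i => ⟨C i, hC i (α i)⟩)
  have hintj := fun j => integrable_prod_pos (P := P) (a := a) (σ := σ) hm hc ht.le (hgc j)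
    (fun i => ⟨C i, hgb j i⟩)
  have hswap : ∫ ω, (∫ s in orderedSimplex n t,
      ∏ i, spatialDeriv (α i) (b i) (a + σ • B (s i).toNNReal ω) (s i)) ∂P
      = ∫ p, ∏ i, G i (α i) (pos B a σ (p.1 i) p.2)
        ∂((volume.restrict (orderedSimplex n t)).prod P) := by
    rw [integral_prod_symm _ hint]
    congr 1 with ω
    refine setIntegral_congr_fun (measurableSet_orderedSimplex n t) fun s hs => ?_
    refine Finset.prod_congr rfl fun i _ => ?_
    exact ((hE i).deriv_eq (α i) _ ⟨(hs.2 i).1, (hs.2 i).2.trans htT⟩).symm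
  have hε0 : Tendsto (fun j : ℕ => (1 : ℝ) / (j + 1)) atTop (𝓝 0) :=
    tendsto_one_div_add_atTop_nhds_zero_nat
  have hpt : ∀ i x, ∀ s ∈ Ioo 0 t, Tendsto (fun j => g j i (x, s)) atTop (𝓝 (G i (α i) (x, s))) :=
    fun i x s hs => by
    rw [tendsto_iff_dist_tendsto_zero]
    refine squeeze_zero' (.of_forall fun j => dist_nonneg) ?_ hε0
    filter_upwards [hε0.eventually_le_const hs.1, hε0.eventually_le_const (sub_pos.2 hs.2)]
      with j h1 h2
    rw [Real.dist_eq]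
    exact hfG i j (α i) x s ⟨h1, by linarith⟩
  -- The approximating derivatives obey the bounds `C i` uniformly in `j`, so a constant dominates
  -- on the finite product measure.
  have hlim : Tendsto (fun j => ∫ p, ∏ i, g j i (pos B a σ (p.1 i) p.2)
      ∂((volume.restrict (orderedSimplex n t)).prod P)) atTop
      (𝓝 (∫ p, ∏ i, G i (α i) (pos B a σ (p.1 i) p.2)
        ∂((volume.restrict (orderedSimplex n t)).prod P))) := by
    refine tendsto_integral_of_dominated_convergence (fun _ => ∏ i, C i)
      (fun j => (hintj j).aestronglyMeasurable) (integrable_const _)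
      (fun j => .of_forall fun p => ?_) ?_
    · rw [Real.norm_eq_abs, Finset.abs_prod]
      exact Finset.prod_le_prod (fun i _ => abs_nonneg _) fun i _ => hgb j i _
    · have := Measure.quasiMeasurePreserving_fst (μ := volume.restrict (orderedSimplex n t))
        (ν := P)
      filter_upwards [this.ae (ae_mem_Ioo_of_orderedSimplex n t)] with p hp
      exact tendsto_finsetProd _ fun i _ => hpt i _ _ (hp i)
  rw [hswap]
  have hbound : ∀ j : ℕ, |∫ p, ∏ i, g j i (pos B a σ (p.1 i) p.2)
      ∂((volume.restrict (orderedSimplex n t)).prod P)|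
      ≤ 4 ^ n * (∏ i, katoConst d r q * σ ^ (-(dimRatio d r + 1)) * lam ^ (-delta1 d r q)
          * ((mixedNorm T r q (b i)).toReal + 1 / (j + 1))) * Real.exp (2 * (lam * t)) :=
    fun j => by
    rw [integral_prod _ (hintj j)]
    refine hB.abs_integral_prod_dd_le hm hc hσ ht (fun i => katoBound_of_mixedNorm hr2 hq hδ hσ
      (hfs i j) (hfc i j) (hHm i j) (hH0 i j) (hfH i j)
      (add_nonneg ENNReal.toReal_nonneg (hε j).le) (hHq i j)) fun i => hft i j (α i)
  refine le_of_tendsto_of_tendsto' hlim.abs ?_ hbound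
  refine (tendsto_const_nhds.mul (tendsto_finsetProd _ fun i _ => tendsto_const_nhds.mul ?_)).mul
    tendsto_const_nhds
  simpa using tendsto_const_nhds.add hε0

end

end DavieBound

theorem theorem2p1 (d : ℕ) (r q : ℝ≥0∞) (hr : (d : ℝ≥0∞) < r) (hr2 : 2 ≤ r) (hq : 2 < q)
    (hδ : 0 < DavieBound.delta1 d r q) :
    ∃ C₃ : ℝ, 0 < C₃ ∧
      ∀ (Ω : Type*) [MeasurableSpace Ω] (P : Measure Ω) [IsProbabilityMeasure P]
        (B : ℝ≥0 → Ω → EuclideanSpace ℝ (Fin d)), DavieBound.IsStandardBrownian B P →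
      ∀ (σ : ℝ), 0 < σ → ∀ (T : ℝ), 0 < T → ∀ t ∈ Icc 0 T,
      ∀ (a : EuclideanSpace ℝ (Fin d)) (n : ℕ), 1 ≤ n →
      ∀ (b : Fin n → EuclideanSpace ℝ (Fin d) → ℝ → ℝ),
        (∀ i, DavieBound.IsC1CompactlySupported T (b i)) →
      ∀ (α : Fin n → Fin d),
        |∫ ω, (∫ s in DavieBound.orderedSimplex n t,
            ∏ i, DavieBound.spatialDeriv (α i) (b i)
              (a + σ • B (s i).toNNReal ω) (s i)) ∂P|
          ≤ C₃ ^ n * σ ^ (-(n * (DavieBound.dimRatio d r + 1)))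
            * (n : ℝ) ^ (-(n * DavieBound.delta1 d r q))
            * t ^ (n * DavieBound.delta1 d r q)
            * ∏ i, (DavieBound.mixedNorm T r q (b i)).toReal := by
  have hK : 0 < |DavieBound.katoConst d r q| + 1 := by positivity
  -- The `4` comes from the iteration step, `e²` per factor from the terminal function at `λ = n/t`;
  -- the `+ 1` ensures positivity.
  refine ⟨4 * (|DavieBound.katoConst d r q| + 1) * Real.exp 2, by positivity, ?_⟩
  intro Ω _ P _ B hB σ hσ T hT t ht a n hn b hb α
  have hn0 : (0 : ℝ) < n := by exact_mod_cast hn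
  -- At `t = 0` the rate `n/t` makes no sense, but the simplex is null since `n ≥ 1`, and both sides
  -- vanish.
  rcases ht.1.eq_or_lt with rfl | ht0
  · have : volume.restrict (DavieBound.orderedSimplex n 0) = 0 :=
      Measure.restrict_eq_zero.2 (DavieBound.volume_orderedSimplex_zero hn)
    rw [this, Real.zero_rpow (mul_pos hn0 hδ).ne']
    simp
  obtain ⟨B', hm, hc, hBB'⟩ := hB.exists_good_version
  have hB' := hB.congr hc hBB'
  have e1 : ∫ ω, (∫ s in DavieBound.orderedSimplex n t, ∏ i, DavieBound.spatialDeriv (α i) (b i)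
        (a + σ • B (s i).toNNReal ω) (s i)) ∂P
      = ∫ ω, (∫ s in DavieBound.orderedSimplex n t, ∏ i, DavieBound.spatialDeriv (α i) (b i)
        (a + σ • B' (s i).toNNReal ω) (s i)) ∂P := by
    refine integral_congr_ae ?_
    filter_upwards [hBB'] with ω hω
    simp_rw [hω]
  -- The rate `λ = n/t` balances `λ^{-nδ₁}` against `e^{2λt}`, up to constants to the power `n`.
  have : Fact (0 < (n : ℝ) / t) := ⟨by positivity⟩
  rw [e1]
  refine (hB'.abs_integral_prod_spatialDeriv_le (lam := n / t) hm hc hσ hT ht0 ht.2 hr2 hq hδ hb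
    α).trans ?_
  have h1 : Real.exp (2 * (n / t * t)) = Real.exp 2 ^ n := by
    rw [div_mul_cancel₀ _ ht0.ne', ← Real.exp_nat_mul, mul_comm]
  have h2 : σ ^ (-(n * (DavieBound.dimRatio d r + 1)))
      = (σ ^ (-(DavieBound.dimRatio d r + 1))) ^ n := by
    rw [← Real.rpow_mul_natCast hσ.le]
    ring_nf
  have h3 : (n : ℝ) ^ (-(n * DavieBound.delta1 d r q)) * t ^ (n * DavieBound.delta1 d r q)
      = (((n : ℝ) / t) ^ (-DavieBound.delta1 d r q)) ^ n := by
    rw [← Real.rpow_mul_natCast (by positivity), Real.div_rpow hn0.le ht0.le, div_eq_mul_inv,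
      ← Real.rpow_neg ht0.le]
    ring_nf
  rw [h1, h2, mul_assoc (_ * _ ^ n), h3]
  simp_rw [Finset.prod_mul_distrib, Finset.prod_const, Finset.card_univ, Fintype.card_fin, mul_pow]
  have h4 : DavieBound.katoConst d r q ^ n ≤ (|DavieBound.katoConst d r q| + 1) ^ n := by
    refine (le_abs_self _).trans ?_
    rw [abs_pow]
    exact pow_le_pow_left₀ (abs_nonneg _) (by linarith) n
  have h5 : 0 ≤ ∏ i, (DavieBound.mixedNorm T r q (b i)).toReal :=
    Finset.prod_nonneg fun i _ => ENNReal.toReal_nonneg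
  calc _ = DavieBound.katoConst d r q ^ n * (4 ^ n * Real.exp 2 ^ n
        * (σ ^ (-(DavieBound.dimRatio d r + 1))) ^ n
        * (((n : ℝ) / t) ^ (-DavieBound.delta1 d r q)) ^ n
        * ∏ i, (DavieBound.mixedNorm T r q (b i)).toReal) := by ring
    _ ≤ (|DavieBound.katoConst d r q| + 1) ^ n * (4 ^ n * Real.exp 2 ^ n
        * (σ ^ (-(DavieBound.dimRatio d r + 1))) ^ n
        * (((n : ℝ) / t) ^ (-DavieBound.delta1 d r q)) ^ n
        * ∏ i, (DavieBound.mixedNorm T r q (b i)).toReal) :=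
      mul_le_mul_of_nonneg_right h4 (by positivity)
    _ = _ := by ring
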